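/- \textbf{The random-surfer tree.} Let $p\in(0,1)$, and let $\mathrm{Geo}(p)$ denote a random variable with $\mathbb{P}(\mathrm{Geo}(p)=k)=(1-p)^kp$ for $k=0,1,2,\dots$. Start with a single vertex $v_0$ (the root) carrying one self-loop. At each step $s=1,\dots,n-1$ a new vertex $v_s$ appears together with one directed edge leaving it, whose head is determined as follows: choose $u$ uniformly at random from $\{v_0,\dots,v_{s-1}\}$ and a fresh random variable $X=\mathrm{Geo}(p)$, perform a simple random walk of length $X$ along directed edges starting from $u$, and join $v_s$ to the last vertex of the walk. (This is the random-surfer Webgraph with out-degree $d=1$.) The $n$-vertex random-surfer tree is obtained by deleting the self-loop of the root and ignoring edge directions. Its height is the maximum graph distance between a vertex and the root. All logarithms are natural. \textbf{Theorem.} For $p\in(0,1)$, let $s=s(p)$ be the unique solution in $(0,1)$ to $$s\log\left(\frac{(1-p)(2-s)}{1-s}\right)=1 .$$ Let $p_0\approx 0.206$ be the unique solution in $(0,1/2)$ to $$\log\left(\frac{1-p}{p}\right)=\frac{1-p}{1-2p} .$$ (These solutions exist and are unique.) Define $c_L,c_U:(0,1)\to\mathbb{R}$ by $$c_L(p)=\exp(1/s)\,s\,(2-s)\,p,\qquad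 c_U(p)=\begin{cases} c_L(p) & \text{if } p_0\le p<1,\\ \left(\log\frac{1-p}{p}\right)^{-1} & \text{if } 0<p<p_0 .\end{cases}$$ Then for every fixed $p\in(0,1)$ and every fixed $\varepsilon>0$, the probability that the height of the $n$-vertex random-surfer tree with parameter $p$ is between $(c_L(p)-\varepsilon)\log n$ and $(c_U(p)+\varepsilon)\log n$ tends to $1$ as $n\to\infty$. -/

import Mathlib

open MeasureTheory ProbabilityTheory Filter Topology

namespace RandomSurfer

/-- A directed multigraph on the vertex set `V` with all out-degrees equal to `d`, given by its
edges: `G v j` is the head of the `j`-th edge that leaves `v`. -/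
abbrev OutGraph (d : ℕ) (V : Type*) := V → Fin d → V

/-- The geometric distribution on `{0, 1, 2, …}`: the mass at `k` is `(1 - p) ^ k * p`
(for `p ≠ 0`). -/
noncomputable def geo (p : unitInterval) : PMF ℕ := (geometricMeasure p).toPMF

/-- The law of the last vertex of a simple random walk of length `k` on `G` started at `u`: every
step follows an out-edge of the current vertex, chosen uniformly at random. -/
noncomputable def walk {d : ℕ} [NeZero d] {V : Type*} (G : OutGraph d V) : ℕ → V → PMF V
  | 0, u => PMF.pure u
  | k + 1, u => (PMF.uniformOfFintype (Fin d)).bind fun j => walk G k (G u j)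

/-- The law of the head of one new edge, given the current graph `G`: a uniformly random vertex
`u`, then a random walk on `G` from `u` whose length is geometric. -/
noncomputable def surf (p : unitInterval) {d : ℕ} [NeZero d] {m : ℕ}
    (G : OutGraph d (Fin (m + 1))) : PMF (Fin (m + 1)) :=
  (PMF.uniformOfFintype (Fin (m + 1))).bind fun u => (geo p).bind fun k => walk G k u

/-- The law of `d` independent samples from `q`. -/
noncomputable def iid (d : ℕ) {n : ℕ} (q : PMF (Fin n)) : PMF (Fin d → Fin n) :=
  (Measure.pi fun _ : Fin d => q.toMeasure).toPMF

/-- Add a new last vertex whose `d` out-edges have heads `h 0, …, h (d - 1)`. -/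
def addVertex {d m : ℕ} (G : OutGraph d (Fin (m + 1))) (h : Fin d → Fin (m + 1)) :
    OutGraph d (Fin (m + 2)) :=
  Fin.snoc (α := fun _ => Fin d → Fin (m + 2))
    (fun i j => (G i j).castSucc) (fun j => (h j).castSucc)

/-- The random-surfer Webgraph with parameters `p` and `d` after `m` steps. It has the `m + 1`
vertices `0, …, m` (in the order of their arrival); vertex `0` is the root, with `d` self-loops. -/
noncomputable def webgraph (p : unitInterval) (d : ℕ) [NeZero d] :
    (m : ℕ) → PMF (OutGraph d (Fin (m + 1)))
  | 0 => PMF.pure fun _ _ => 0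
  | m + 1 => (webgraph p d m).bind fun G => (iid d (surf p G)).map (addVertex G)

/-- The underlying undirected simple graph: directions are ignored and self-loops deleted. -/
def underlying {d : ℕ} {V : Type*} (G : OutGraph d V) : SimpleGraph V :=
  SimpleGraph.fromRel fun u v => ∃ j, G u j = v

/-- The random-surfer tree with parameter `p` on `m + 1` vertices. -/
noncomputable def surferTree (p : unitInterval) (m : ℕ) : PMF (SimpleGraph (Fin (m + 1))) :=
  (webgraph p 1 m).map underlying

/-- The height: the largest graph distance between a vertex and the root `0`. -/
noncomputable def height {m : ℕ} (T : SimpleGraph (Fin (m + 1))) : ℕ :=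
  Finset.univ.sup fun v => T.dist 0 v

/-- `s` is a solution in `(0, 1)` of `s log ((1 - p) (2 - s) / (1 - s)) = 1`. -/
def IsS (p s : ℝ) : Prop :=
  s ∈ Set.Ioo (0 : ℝ) 1 ∧ s * Real.log ((1 - p) * (2 - s) / (1 - s)) = 1

/-- `q` is a solution in `(0, 1/2)` of `log ((1 - q) / q) = (1 - q) / (1 - 2 q)`. -/
def IsP0 (q : ℝ) : Prop :=
  q ∈ Set.Ioo (0 : ℝ) (1 / 2) ∧ Real.log ((1 - q) / q) = (1 - q) / (1 - 2 * q)

/-- The constant `c_L(p)`, where `s = s(p)`. -/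
noncomputable def cL (p s : ℝ) : ℝ := Real.exp (1 / s) * s * (2 - s) * p

/-- The constant `c_U(p)`, where `s = s(p)` and `p₀` is the threshold. -/
noncomputable def cU (p₀ p s : ℝ) : ℝ :=
  if p₀ ≤ p then cL p s else (Real.log ((1 - p) / p))⁻¹

end RandomSurfer

/-! With one out-edge per vertex, climbing k edges from u lowers its depth by k, stopping at the
root. So the depths form a Markov chain in which the new depth is (δ u - k)⁺ + 1, with u uniform and
k geometric (`webgraph_depths`), and the height is the maximal depth. Write φ = `mgfStep p` for the
moment generating function of 1 - Geo(p). Apart from the truncation, this is a branching-type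
recursion: adding a vertex to m + 1 others multiplies the mean of ∑ exp(θ δ v) by 1 + φ(θ)/(m + 1).

Upper bound: that mean is at most C n ^ y for each y > φ(θ), provided y ≥ 1. The proviso pays for
vertices attached at the root by truncation, which may contribute a constant at each step. Markov's
inequality bounds the height by c log n whenever c > φ(θ)/θ and φ(θ) ≥ 1 (`tendsto_upperTail`). The
critical point of φ(θ)/θ is θ = 1/s, where its value is `cL`; it is admissible when p ≥ p₀. For
smaller p the choice is the θ with φ(θ) = 1, namely log((1 - p)/p).

Lower bound: truncation only raises depths, so it may be ignored for monotone functions f.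
Estimating E exp(-∑ f(δ v)) backwards in time replaces f by f plus its average over a step, damped
by some α < 1 that pays for exp(-y) ≤ 1 - α y at small y. When the number of vertices grows by a
large factor K, the pulled-back indicator of depth ≥ h + c₁ log K dominates that of depth ≥ h
(`exists_block`). Iterating from t vertices bounds the failure probability by exp(-t lam)
(`laplaceCount_iterate`). Any c₁ < φ'(θ) with θ < 1/s is attainable for α near 1, and φ'(1/s) = `cL`
(`IsS.exists_tilt`). -/

namespace RandomSurfer

/-! ### Reduction of the random tree to the Markov chain of depths -/

/-- `δ` is the depth function of the rooted tree given by the out-edges of `G`. -/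
def IsDepth {m : ℕ} (G : OutGraph 1 (Fin (m + 1))) (δ : Fin (m + 1) → ℕ) : Prop :=
  G 0 0 = 0 ∧ δ 0 = 0 ∧ ∀ v, v ≠ 0 → δ v = δ (G v 0) + 1

namespace IsDepth

variable {m : ℕ} {G : OutGraph 1 (Fin (m + 1))} {δ : Fin (m + 1) → ℕ}

/-- The self-loop of the root matches the truncated subtraction 0 - 1 = 0, so the root needs no
separate treatment in walks. -/
lemma apply_out (h : IsDepth G δ) (v : Fin (m + 1)) (j : Fin 1) : δ (G v j) = δ v - 1 := by
  obtain rfl : j = 0 := Subsingleton.elim _ _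
  by_cases hv : v = 0
  · subst hv; rw [h.1, h.2.1]
  · rw [h.2.2 v hv]; simp

lemma le_of_adj (h : IsDepth G δ) {u v : Fin (m + 1)} (huv : (underlying G).Adj u v) :
    δ v ≤ δ u + 1 := by
  rw [underlying, SimpleGraph.fromRel_adj] at huv
  obtain ⟨-, ⟨j, rfl⟩ | ⟨j, rfl⟩⟩ := huv
  · rw [h.apply_out]; omega
  · rw [h.apply_out]; omega

lemma le_length (h : IsDepth G δ) {u v : Fin (m + 1)} (w : (underlying G).Walk u v) :
    δ v ≤ δ u + w.length := by
  induction w with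
  | nil => simp
  | cons hadj w ih =>
    have := h.le_of_adj hadj
    rw [SimpleGraph.Walk.length_cons]
    omega

lemma exists_walk (h : IsDepth G δ) (n : ℕ) :
    ∀ v, δ v = n → ∃ w : (underlying G).Walk 0 v, w.length = n := by
  induction n with
  | zero =>
    intro v hv
    obtain rfl : v = 0 := by
      by_contra hne
      have := h.2.2 v hne
      omega
    exact ⟨.nil, rfl⟩
  | succ n ih =>
    intro v hv
    have hv0 : v ≠ 0 := by
      rintro rfl
      rw [h.2.1] at hv
      omega
    have hout := h.2.2 v hv0
    obtain ⟨w, hw⟩ := ih (G v 0) (by omega)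
    have hadj : (underlying G).Adj (G v 0) v := by
      rw [underlying, SimpleGraph.fromRel_adj]
      refine ⟨fun he => ?_, Or.inr ⟨0, rfl⟩⟩
      rw [he] at hout
      omega
    exact ⟨w.concat hadj, by rw [SimpleGraph.Walk.length_concat, hw]⟩

lemma dist_eq (h : IsDepth G δ) (v : Fin (m + 1)) : (underlying G).dist 0 v = δ v := by
  obtain ⟨w, hw⟩ := h.exists_walk _ v rfl
  refine le_antisymm (hw ▸ SimpleGraph.dist_le w) ?_
  obtain ⟨w', hw'⟩ := (SimpleGraph.Walk.reachable w).exists_walk_length_eq_dist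
  have := h.le_length w'
  rw [h.2.1] at this
  omega

lemma addVertex (h : IsDepth G δ) (e : Fin 1 → Fin (m + 1)) :
    IsDepth (RandomSurfer.addVertex G e) (Fin.snoc (α := fun _ => ℕ) δ (δ (e 0) + 1)) := by
  have hcast : ∀ v : Fin (m + 1), RandomSurfer.addVertex G e v.castSucc 0 = (G v 0).castSucc :=
    fun v => by simp [RandomSurfer.addVertex]
  have hzero : (0 : Fin (m + 2)) = (0 : Fin (m + 1)).castSucc := rfl
  refine ⟨?_, ?_, fun v => ?_⟩
  · rw [hzero, hcast, h.1]
  · exact (congrArg _ hzero).trans ((Fin.snoc_castSucc (α := fun _ => ℕ) _ _ _).trans h.2.1)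
  · refine Fin.lastCases (fun _ => ?_) (fun v hv => ?_) v
    · simp [RandomSurfer.addVertex]
    · rw [hcast, Fin.snoc_castSucc, Fin.snoc_castSucc]
      exact h.2.2 v fun h0 => hv (by rw [h0, hzero])

lemma map_walk (h : IsDepth G δ) (k : ℕ) :
    ∀ u, (walk G k u).map δ = PMF.pure (δ u - k) := by
  induction k with
  | zero => intro u; simp [walk, PMF.pure_map]
  | succ k ih =>
    intro u
    simp only [walk, PMF.map_bind, ih, h.apply_out]
    rw [PMF.bind_const]
    congr 1
    omega

end IsDepth

lemma map_iid_one {n : ℕ} (q : PMF (Fin n)) : (iid 1 q).map (fun e => e 0) = q := by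
  apply PMF.toMeasure_injective
  rw [← PMF.toMeasure_map _ (iid 1 q) (measurable_pi_apply 0), iid, Measure.toPMF_toMeasure]
  exact (measurePreserving_eval (fun _ : Fin 1 => q.toMeasure) 0).map_eq

lemma bind_congr_support {α β : Type*} (q : PMF α) {f g : α → PMF β}
    (h : ∀ a ∈ q.support, f a = g a) : q.bind f = q.bind g := by
  ext b
  rw [PMF.bind_apply, PMF.bind_apply]
  refine tsum_congr fun a => ?_
  by_cases ha : a ∈ q.support
  · rw [h a ha]
  · rw [(q.apply_eq_zero_iff a).2 ha, zero_mul, zero_mul]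

/-- One step of the process of depths: the new vertex goes below the vertex that is reached from a
uniformly random vertex by climbing a geometric number of steps. -/
noncomputable def depthStep (p : unitInterval) {m : ℕ} (δ : Fin (m + 1) → ℕ) :
    PMF (Fin (m + 2) → ℕ) :=
  (PMF.uniformOfFintype (Fin (m + 1))).bind fun u =>
    (geo p).map fun k => Fin.snoc (α := fun _ => ℕ) δ (δ u - k + 1)

/-- The law of the depths of the vertices of the random-surfer tree. -/
noncomputable def depths (p : unitInterval) : (m : ℕ) → PMF (Fin (m + 1) → ℕ)
  | 0 => PMF.pure 0
  | m + 1 => (depths p m).bind (depthStep p)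

lemma map_surf {m : ℕ} (p : unitInterval) {G : OutGraph 1 (Fin (m + 1))}
    {δ : Fin (m + 1) → ℕ} (h : IsDepth G δ) :
    (surf p G).map (fun v => Fin.snoc (α := fun _ => ℕ) δ (δ v + 1)) = depthStep p δ := by
  have : (fun v => Fin.snoc (α := fun _ => ℕ) δ (δ v + 1) : Fin (m + 1) → Fin (m + 2) → ℕ) =
      (fun x : ℕ => Fin.snoc (α := fun _ => ℕ) δ (x + 1)) ∘ δ := rfl
  rw [this, ← PMF.map_comp]
  simp only [surf, depthStep, PMF.map_bind, h.map_walk, PMF.pure_map]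
  rfl

/-- Both claims go through one induction: the law of the next depth is computed from `IsDepth`,
which is known only for graphs in the support. -/
theorem webgraph_depths (p : unitInterval) (m : ℕ) :
    (∀ G ∈ (webgraph p 1 m).support, IsDepth G fun v => (underlying G).dist 0 v) ∧
      (webgraph p 1 m).map (fun G v => (underlying G).dist 0 v) = depths p m := by
  induction m with
  | zero =>
    have h0 : IsDepth (fun _ _ => 0 : OutGraph 1 (Fin (0 + 1))) 0 :=
      ⟨rfl, rfl, fun v hv => absurd (Fin.ext (by have := v.isLt; simp)) hv⟩
    have h1 : (fun v => (underlying (fun _ _ => 0 : OutGraph 1 (Fin (0 + 1)))).dist 0 v) = 0 :=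
      funext h0.dist_eq
    refine ⟨fun G hG => ?_, ?_⟩
    · rw [webgraph, PMF.mem_support_pure_iff] at hG
      subst hG
      rw [h1]
      exact h0
    · rw [webgraph, PMF.pure_map, h1, depths]
  | succ m ih =>
    obtain ⟨ih1, ih2⟩ := ih
    have key : ∀ G ∈ (webgraph p 1 m).support, ∀ e, IsDepth (addVertex G e)
        (Fin.snoc (α := fun _ => ℕ) (fun v => (underlying G).dist 0 v)
          ((underlying G).dist 0 (e 0) + 1)) := fun G hG e => (ih1 G hG).addVertex e
    refine ⟨fun G hG => ?_, ?_⟩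
    · rw [webgraph, PMF.mem_support_bind_iff] at hG
      obtain ⟨G', hG', hG⟩ := hG
      rw [PMF.mem_support_map_iff] at hG
      obtain ⟨e, -, rfl⟩ := hG
      rw [funext (key G' hG' e).dist_eq]
      exact key G' hG' e
    · rw [webgraph, PMF.map_bind, depths, ← ih2, PMF.bind_map]
      refine bind_congr_support _ fun G hG => ?_
      rw [Function.comp_apply, ← map_surf p (ih1 G hG)]
      conv_rhs => rw [← map_iid_one (surf p G)]
      rw [PMF.map_comp, PMF.map_comp]
      congr 1
      funext e
      exact funext (key G hG e).dist_eq

theorem map_height_surferTree (p : unitInterval) (m : ℕ) :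
    (surferTree p m).map height = (depths p m).map fun δ => Finset.univ.sup δ := by
  rw [← (webgraph_depths p m).2, surferTree, PMF.map_comp, PMF.map_comp]
  rfl

/-! ### Expectations and the geometric law -/

/-- The expectation of a nonnegative function under a probability mass function. -/
noncomputable def expect {α : Type*} (P : PMF α) (F : α → ENNReal) : ENNReal := ∑' a, P a * F a

section expect

variable {α β : Type*}

lemma expect_bind (P : PMF α) (f : α → PMF β) (F : β → ENNReal) :
    expect (P.bind f) F = expect P fun a => expect (f a) F := by
  simp only [expect, PMF.bind_apply, ← ENNReal.tsum_mul_right, ← ENNReal.tsum_mul_left]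
  rw [ENNReal.tsum_comm]
  simp only [mul_assoc]

lemma expect_pure (a : α) (F : α → ENNReal) : expect (PMF.pure a) F = F a := by
  rw [expect, tsum_eq_single a]
  · simp
  · intro b hb
    simp [PMF.pure_apply, hb]

lemma expect_map (P : PMF α) (f : α → β) (F : β → ENNReal) :
    expect (P.map f) F = expect P (F ∘ f) := by
  rw [← PMF.bind_pure_comp, expect_bind]
  simp only [Function.comp_apply, expect_pure]
  rfl

lemma expect_mono (P : PMF α) {F H : α → ENNReal} (h : ∀ a, F a ≤ H a) :
    expect P F ≤ expect P H :=
  ENNReal.tsum_le_tsum fun a => mul_le_mul_right (h a) _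

lemma expect_const (P : PMF α) (c : ENNReal) : expect P (fun _ => c) = c := by
  rw [expect, ENNReal.tsum_mul_right, P.tsum_coe, one_mul]

lemma expect_add (P : PMF α) (F H : α → ENNReal) :
    expect P (fun a => F a + H a) = expect P F + expect P H := by
  simp only [expect, mul_add]
  exact ENNReal.tsum_add

lemma expect_const_mul (P : PMF α) (c : ENNReal) (F : α → ENNReal) :
    expect P (fun a => c * F a) = c * expect P F := by
  simp only [expect, ← ENNReal.tsum_mul_left]
  exact tsum_congr fun a => by ring

lemma toMeasure_map_le_expect (P : PMF α) (f : α → ℕ) (S : Set ℕ) {F : α → ENNReal}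
    (h : ∀ a, f a ∈ S → 1 ≤ F a) : (P.map f).toMeasure S ≤ expect P F := by
  rw [PMF.toMeasure_apply_eq_toOuterMeasure, PMF.toOuterMeasure_map_apply,
    PMF.toOuterMeasure_apply]
  refine ENNReal.tsum_le_tsum fun a => ?_
  by_cases ha : a ∈ f ⁻¹' S
  · rw [Set.indicator_of_mem ha]
    exact le_mul_of_one_le_right' (h a ha)
  · rw [Set.indicator_of_notMem ha]
    exact zero_le

lemma expect_uniform {n : ℕ} (F : Fin (n + 1) → ENNReal) :
    expect (PMF.uniformOfFintype (Fin (n + 1))) F = ((n : ENNReal) + 1)⁻¹ * ∑ u, F u := by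
  rw [expect, tsum_fintype, Finset.mul_sum]
  simp [PMF.uniformOfFintype_apply]

end expect

/-- The mass at `k` of the geometric distribution. -/
noncomputable def geoMass (p : ℝ) (k : ℕ) : ℝ := (1 - p) ^ k * p

lemma geo_apply {p : unitInterval} (hp : p ≠ 0) (k : ℕ) :
    geo p k = ENNReal.ofReal (geoMass p k) := by
  rw [geo, Measure.toPMF_apply, geometricMeasure_singleton hp, geoMass]

lemma geoMass_nonneg {p : ℝ} (hp : p ∈ Set.Ioo (0 : ℝ) 1) (k : ℕ) : 0 ≤ geoMass p k :=
  mul_nonneg (pow_nonneg (by linarith [hp.2]) k) hp.1.le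

lemma hasSum_geoMass {p : ℝ} (hp : p ∈ Set.Ioo (0 : ℝ) 1) : HasSum (geoMass p) 1 := by
  have h := (hasSum_geometric_of_lt_one (r := 1 - p) (by linarith [hp.2])
    (by linarith [hp.1])).mul_right p
  rwa [sub_sub_cancel, inv_mul_cancel₀ hp.1.ne'] at h

lemma summable_geoMass_mul {p : ℝ} (hp : p ∈ Set.Ioo (0 : ℝ) 1) {f : ℕ → ℝ} {B : ℝ}
    (h0 : ∀ k, 0 ≤ f k) (hB : ∀ k, f k ≤ B) : Summable fun k => geoMass p k * f k :=
  Summable.of_nonneg_of_le (fun k => mul_nonneg (geoMass_nonneg hp k) (h0 k))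
    (fun k => mul_le_mul_of_nonneg_left (hB k) (geoMass_nonneg hp k))
    ((hasSum_geoMass hp).summable.mul_right B)

lemma expect_geo_le {p : ℝ} (hp : p ∈ Set.Ioo (0 : ℝ) 1) {F B : ℕ → ℝ} {S : ℝ}
    (hF : ∀ k, F k ≤ B k) (h0 : ∀ k, 0 ≤ B k) (hS : HasSum (fun k => geoMass p k * B k) S) :
    expect (geo ⟨p, Set.Ioo_subset_Icc_self hp⟩) (fun k => ENNReal.ofReal (F k)) ≤
      ENNReal.ofReal S := by
  have hp0 : (⟨p, Set.Ioo_subset_Icc_self hp⟩ : unitInterval) ≠ 0 := fun h =>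
    hp.1.ne' (congrArg Subtype.val h)
  rw [← hS.tsum_eq, ENNReal.ofReal_tsum_of_nonneg
    (fun k => mul_nonneg (geoMass_nonneg hp k) (h0 k)) hS.summable]
  refine ENNReal.tsum_le_tsum fun k => ?_
  rw [geo_apply hp0, ENNReal.ofReal_mul (geoMass_nonneg hp k)]
  exact mul_le_mul_right (ENNReal.ofReal_le_ofReal (hF k)) _

lemma expect_depthStep_le {p : ℝ} (hp : p ∈ Set.Ioo (0 : ℝ) 1) {m : ℕ} (δ : Fin (m + 1) → ℕ)
    {F : (Fin (m + 2) → ℕ) → ℝ} {B : Fin (m + 1) → ℕ → ℝ} {S : Fin (m + 1) → ℝ}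
    (hF : ∀ u k, F (Fin.snoc (α := fun _ => ℕ) δ (δ u - k + 1)) ≤ B u k)
    (h0 : ∀ u k, 0 ≤ B u k) (hS : ∀ u, HasSum (fun k => geoMass p k * B u k) (S u)) :
    expect (depthStep ⟨p, Set.Ioo_subset_Icc_self hp⟩ δ) (fun δ' => ENNReal.ofReal (F δ')) ≤
      ENNReal.ofReal (((m : ℝ) + 1)⁻¹ * ∑ u, S u) := by
  have hS0 : ∀ u, 0 ≤ S u := fun u =>
    (hS u).nonneg fun k => mul_nonneg (geoMass_nonneg hp k) (h0 u k)
  have hm : (0 : ℝ) < m + 1 := by positivity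
  rw [depthStep, expect_bind, expect_uniform, ENNReal.ofReal_mul (by positivity),
    ENNReal.ofReal_inv_of_pos hm, ENNReal.ofReal_sum_of_nonneg fun u _ => hS0 u,
    ENNReal.ofReal_add (by positivity) zero_le_one, ENNReal.ofReal_natCast, ENNReal.ofReal_one]
  refine mul_le_mul_right (Finset.sum_le_sum fun u _ => ?_) _
  rw [expect_map]
  exact expect_geo_le hp (hF u) (h0 u) (hS u)

/-! ### Backward operators on monotone profiles -/

/-- The averaging operator of one step `1 - Geo(p)`. -/
noncomputable def stepAverage (p : ℝ) (f : ℝ → ℝ) (x : ℝ) : ℝ :=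
  ∑' k : ℕ, geoMass p k * f (x + 1 - k)

/-- The backward operator of the (damped) mean profile when a vertex joins `m + 1` vertices. -/
noncomputable def backStep (α p : ℝ) (m : ℕ) (f : ℝ → ℝ) (x : ℝ) : ℝ :=
  f x + α / (m + 1) * stepAverage p f x

/-- The composition of the backward operators from `m + k + 1` vertices down to `m + 1`. -/
noncomputable def back (α p : ℝ) : ℕ → ℕ → (ℝ → ℝ) → ℝ → ℝ
  | _, 0, f => f
  | m, k + 1, f => backStep α p m (back α p (m + 1) k f)

/-- Monotone functions with values in `[0, B]`. -/
def IsProfile (B : ℝ) (f : ℝ → ℝ) : Prop := Monotone f ∧ ∀ x, 0 ≤ f x ∧ f x ≤ B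

section operators

variable {p α B : ℝ} {f : ℝ → ℝ}

lemma IsProfile.hasSum (hp : p ∈ Set.Ioo (0 : ℝ) 1) (hf : IsProfile B f) (x : ℝ) :
    HasSum (fun k : ℕ => geoMass p k * f (x + 1 - k)) (stepAverage p f x) :=
  (summable_geoMass_mul hp (fun _ => (hf.2 _).1) fun _ => (hf.2 _).2).hasSum

lemma IsProfile.stepAverage (hp : p ∈ Set.Ioo (0 : ℝ) 1) (hf : IsProfile B f) :
    IsProfile B (stepAverage p f) := by
  refine ⟨fun x y hxy => ?_, fun x => ⟨?_, ?_⟩⟩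
  · exact hasSum_le (fun k => mul_le_mul_of_nonneg_left (hf.1 (by linarith))
      (geoMass_nonneg hp k)) (hf.hasSum hp x) (hf.hasSum hp y)
  · exact (hf.hasSum hp x).nonneg fun k => mul_nonneg (geoMass_nonneg hp k) (hf.2 _).1
  · have h := hasSum_le (fun k => mul_le_mul_of_nonneg_left (hf.2 _).2
      (geoMass_nonneg hp k)) (hf.hasSum hp x) ((hasSum_geoMass hp).mul_right B)
    rwa [one_mul] at h

lemma IsProfile.backStep (hp : p ∈ Set.Ioo (0 : ℝ) 1) (hα : α ∈ Set.Icc (0 : ℝ) 1)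
    (hf : IsProfile B f) (m : ℕ) :
    IsProfile (B * ((m + 2) / (m + 1))) (backStep α p m f) := by
  have ha : 0 ≤ α / ((m : ℝ) + 1) := div_nonneg hα.1 (by positivity)
  have hs := hf.stepAverage hp
  refine ⟨fun x y hxy => ?_, fun x => ⟨?_, ?_⟩⟩
  · exact add_le_add (hf.1 hxy) (mul_le_mul_of_nonneg_left (hs.1 hxy) ha)
  · exact add_nonneg (hf.2 x).1 (mul_nonneg ha (hs.2 x).1)
  · have h1 : α / ((m : ℝ) + 1) ≤ 1 / ((m : ℝ) + 1) := by
      gcongr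
      exact hα.2
    have h2 : α / ((m : ℝ) + 1) * RandomSurfer.stepAverage p f x ≤ 1 / ((m : ℝ) + 1) * B :=
      mul_le_mul h1 (hs.2 x).2 (hs.2 x).1 (by positivity)
    have h3 : B * (((m : ℝ) + 2) / (m + 1)) = B + 1 / ((m : ℝ) + 1) * B := by
      field_simp
      ring
    rw [h3]
    exact add_le_add (hf.2 x).2 h2

lemma IsProfile.back (hp : p ∈ Set.Ioo (0 : ℝ) 1) (hα : α ∈ Set.Icc (0 : ℝ) 1)
    (hf : IsProfile B f) (k : ℕ) :
    ∀ m : ℕ, IsProfile (B * ((m + k + 1) / (m + 1))) (back α p m k f) := by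
  induction k with
  | zero =>
    intro m
    have : ((m : ℝ) + (0 : ℕ) + 1) / (m + 1) = 1 := by
      rw [Nat.cast_zero, add_zero, div_self (by positivity)]
    rw [this, mul_one]
    exact hf
  | succ k ih =>
    intro m
    have h := (ih (m + 1)).backStep hp hα m
    have h2 : B * (((m : ℝ) + (k + 1 : ℕ) + 1) / (m + 1)) =
        B * ((((m + 1 : ℕ) : ℝ) + k + 1) / ((m + 1 : ℕ) + 1)) * ((m + 2) / (m + 1)) := by
      push_cast
      field_simp
      ring
    rw [h2]
    exact h

lemma sum_snoc {m : ℕ} (g : ℝ → ℝ) (δ : Fin (m + 1) → ℕ) (x : ℕ) :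
    ∑ v, g ((Fin.snoc (α := fun _ => ℕ) δ x v : ℕ)) = ∑ v, g (δ v) + g x := by
  rw [Fin.sum_univ_castSucc]
  simp

/-- Condition on δ. The new depth is at least δ u + 1 - k, so monotonicity of f removes the
truncation; `hexp` then linearises the factor of the new vertex, and 1 - z ≤ exp(-z) puts its
average back into the exponent. -/
lemma expect_exp_neg_succ_le (hp : p ∈ Set.Ioo (0 : ℝ) 1) (hf : IsProfile B f)
    (hexp : ∀ y, 0 ≤ y → y ≤ B → Real.exp (-y) ≤ 1 - α * y) (m : ℕ) :
    expect (depths ⟨p, Set.Ioo_subset_Icc_self hp⟩ (m + 1))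
        (fun δ => ENNReal.ofReal (Real.exp (-∑ v, f (δ v)))) ≤
      expect (depths ⟨p, Set.Ioo_subset_Icc_self hp⟩ m)
        (fun δ => ENNReal.ofReal (Real.exp (-∑ v, backStep α p m f (δ v)))) := by
  rw [depths, expect_bind]
  refine expect_mono _ fun δ => ?_
  set E := Real.exp (-∑ v, f (δ v)) with hE
  have hE0 : 0 < E := Real.exp_pos _
  have hlow : ∀ x, Real.exp (-f x) ≤ 1 - α * f x := fun x => hexp _ (hf.2 x).1 (hf.2 x).2
  refine (expect_depthStep_le hp δ
    (F := fun δ' => Real.exp (-∑ v, f (δ' v)))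
    (B := fun u k => E * (1 - α * f ((δ u : ℝ) + 1 - k)))
    (S := fun u => E * (1 - α * stepAverage p f (δ u))) ?_ ?_ ?_).trans
      (ENNReal.ofReal_le_ofReal ?_)
  · intro u k
    rw [sum_snoc, neg_add, Real.exp_add]
    refine mul_le_mul_of_nonneg_left ((Real.exp_le_exp.2 (neg_le_neg (hf.1 ?_))).trans (hlow _))
      hE0.le
    have : (δ u : ℝ) ≤ ((δ u - k : ℕ) : ℝ) + k := by
      exact_mod_cast le_tsub_add
    push_cast
    linarith
  · exact fun u k => mul_nonneg hE0.le ((Real.exp_pos _).le.trans (hlow _))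
  · intro u
    have h := (((hasSum_geoMass hp).sub ((hf.hasSum hp (δ u)).mul_left α))).mul_left E
    convert! h using 2 with k
    ring
  · have h1 : ((m : ℝ) + 1)⁻¹ * ∑ u, E * (1 - α * stepAverage p f (δ u)) =
        E * (1 - α / (m + 1) * ∑ u, stepAverage p f (δ u)) := by
      rw [← Finset.mul_sum, Finset.sum_sub_distrib, ← Finset.mul_sum]
      simp only [Finset.sum_const, Finset.card_univ, Fintype.card_fin, nsmul_eq_mul]
      push_cast
      field_simp
    have h2 : ∑ v, backStep α p m f (δ v) =
        ∑ v, f (δ v) + α / (m + 1) * ∑ u, stepAverage p f (δ u) := by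
      simp only [backStep, Finset.sum_add_distrib, Finset.mul_sum]
    rw [h1, h2, neg_add, Real.exp_add]
    refine mul_le_mul_of_nonneg_left ?_ hE0.le
    have := Real.add_one_le_exp (-(α / ((m : ℝ) + 1) * ∑ u, stepAverage p f (δ u)))
    linarith

lemma expect_exp_neg_back_le (hp : p ∈ Set.Ioo (0 : ℝ) 1) (hα : α ∈ Set.Icc (0 : ℝ) 1)
    (hB : 0 ≤ B) (hf : IsProfile B f) (k : ℕ) : ∀ m : ℕ,
    (∀ y, 0 ≤ y → y ≤ B * ((m + k + 1) / (m + 1)) → Real.exp (-y) ≤ 1 - α * y) →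
    expect (depths ⟨p, Set.Ioo_subset_Icc_self hp⟩ (m + k))
        (fun δ => ENNReal.ofReal (Real.exp (-∑ v, f (δ v)))) ≤
      expect (depths ⟨p, Set.Ioo_subset_Icc_self hp⟩ m)
        (fun δ => ENNReal.ofReal (Real.exp (-∑ v, back α p m k f (δ v)))) := by
  induction k with
  | zero => intro m _; exact le_rfl
  | succ k ih =>
    intro m hexp
    -- The range on which `hexp` is needed shrinks as the base m increases, so the hypothesis at m
    -- serves the whole induction.
    have hexp' : ∀ y, 0 ≤ y → y ≤ B * ((((m + 1 : ℕ) : ℝ) + k + 1) / ((m + 1 : ℕ) + 1)) →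
        Real.exp (-y) ≤ 1 - α * y := by
      refine fun y hy0 hy => hexp y hy0 (hy.trans (mul_le_mul_of_nonneg_left ?_ hB))
      push_cast
      exact div_le_div₀ (by positivity) (by linarith) (by positivity) (by linarith)
    have h1 := ih (m + 1) hexp'
    rw [show m + 1 + k = m + (k + 1) by ring] at h1
    exact h1.trans (expect_exp_neg_succ_le hp (hf.back hp hα k (m + 1)) hexp' m)

end operators

/-! ### Exponentials as eigenfunctions, and the growth of their coefficients -/

/-- The moment generating function of `1 - Geo(p)`. -/
noncomputable def mgfStep (p θ : ℝ) : ℝ := p * Real.exp θ / (1 - (1 - p) * Real.exp (-θ))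

section mgf

variable {p θ : ℝ}

lemma one_sub_mul_exp_neg_lt_one (hp : p ∈ Set.Ioo (0 : ℝ) 1) (hθ : 0 < θ) :
    (1 - p) * Real.exp (-θ) < 1 := by
  have h1 : Real.exp (-θ) < 1 := Real.exp_lt_one_iff.2 (by linarith)
  nlinarith [hp.1, hp.2, Real.exp_pos (-θ)]

lemma mgfStep_pos (hp : p ∈ Set.Ioo (0 : ℝ) 1) (hθ : 0 < θ) : 0 < mgfStep p θ :=
  div_pos (mul_pos hp.1 (Real.exp_pos _)) (by linarith [one_sub_mul_exp_neg_lt_one hp hθ])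

lemma hasSum_geoMass_mul_exp (hp : p ∈ Set.Ioo (0 : ℝ) 1) (hθ : 0 < θ) (x : ℝ) :
    HasSum (fun k : ℕ => geoMass p k * Real.exp (θ * (x + 1 - k)))
      (mgfStep p θ * Real.exp (θ * x)) := by
  have h := (hasSum_geometric_of_lt_one (r := (1 - p) * Real.exp (-θ))
    (mul_nonneg (by linarith [hp.2]) (Real.exp_pos _).le)
    (one_sub_mul_exp_neg_lt_one hp hθ)).mul_left (p * Real.exp θ * Real.exp (θ * x))
  convert! h using 1
  · funext k
    rw [geoMass, mul_pow, ← Real.exp_nat_mul, show θ * (x + 1 - k) = θ + θ * x + k * -θ by ring,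
      Real.exp_add, Real.exp_add]
    ring
  · rw [mgfStep]
    ring

end mgf

/-- The product of `1 + y / j` over `j = m + 1, …, m + k`. -/
noncomputable def growth (y : ℝ) : ℕ → ℕ → ℝ
  | _, 0 => 1
  | m, k + 1 => (1 + y / (m + 1)) * growth y (m + 1) k

lemma growth_pos {y : ℝ} (hy : 0 ≤ y) (k : ℕ) : ∀ m, 0 < growth y m k := by
  induction k with
  | zero => exact fun m => zero_lt_one
  | succ k ih => exact fun m => mul_pos (by positivity) (ih _)

lemma log_growth_le {y : ℝ} (hy : 0 ≤ y) (k : ℕ) : ∀ m : ℕ, 0 < m →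
    Real.log (growth y m k) ≤ y * Real.log ((m + k) / m) := by
  induction k with
  | zero =>
    intro m hm
    have : (m : ℝ) ≠ 0 := by positivity
    simp [growth, this]
  | succ k ih =>
    intro m hm
    have hm' : (0 : ℝ) < m := by exact_mod_cast hm
    rw [growth, Real.log_mul (by positivity) (growth_pos hy k _).ne']
    have h1 := ih (m + 1) (by omega)
    have h2 : Real.log (1 + y / (m + 1)) ≤ y / (m + 1) := by
      have := Real.log_le_sub_one_of_pos (show 0 < 1 + y / ((m : ℝ) + 1) by positivity)
      linarith
    have h3 : 1 / ((m : ℝ) + 1) ≤ Real.log ((m + 1) / m) := by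
      have h := Real.one_sub_inv_le_log_of_pos (show 0 < ((m : ℝ) + 1) / m by positivity)
      refine le_trans (le_of_eq ?_) h
      field_simp
      ring
    have h4 : Real.log (((m : ℝ) + (k + 1 : ℕ)) / m) =
        Real.log ((m + 1) / m) + Real.log ((((m + 1 : ℕ) : ℝ) + k) / (m + 1 : ℕ)) := by
      rw [← Real.log_mul (by positivity) (by positivity)]
      congr 1
      push_cast
      field_simp
      ring
    rw [h4, mul_add]
    have h5 : y / ((m : ℝ) + 1) = y * (1 / (m + 1)) := by ring
    have h6 := mul_le_mul_of_nonneg_left h3 hy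
    linarith

lemma le_log_growth {y : ℝ} (hy : 0 ≤ y) (k : ℕ) : ∀ m : ℕ,
    y * Real.log ((m + k + 1 + y) / (m + 1 + y)) ≤ Real.log (growth y m k) := by
  induction k with
  | zero =>
    intro m
    have : (m : ℝ) + 1 + y ≠ 0 := by positivity
    simp [growth, this]
  | succ k ih =>
    intro m
    rw [growth, Real.log_mul (by positivity) (growth_pos hy k _).ne']
    have h1 := ih (m + 1)
    have h2 : y / (m + 1 + y) ≤ Real.log (1 + y / (m + 1)) := by
      have h := Real.one_sub_inv_le_log_of_pos (show 0 < 1 + y / ((m : ℝ) + 1) by positivity)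
      refine le_trans (le_of_eq ?_) h
      field_simp
      ring
    have h3 : Real.log (((m : ℝ) + 2 + y) / (m + 1 + y)) ≤ 1 / (m + 1 + y) := by
      have h := Real.log_le_sub_one_of_pos
        (show 0 < ((m : ℝ) + 2 + y) / (m + 1 + y) by positivity)
      refine h.trans (le_of_eq ?_)
      field_simp
      ring
    have h4 : Real.log (((m : ℝ) + (k + 1 : ℕ) + 1 + y) / (m + 1 + y)) =
        Real.log ((m + 2 + y) / (m + 1 + y)) +
          Real.log ((((m + 1 : ℕ) : ℝ) + k + 1 + y) / ((m + 1 : ℕ) + 1 + y)) := by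
      rw [← Real.log_mul (by positivity) (by positivity)]
      congr 1
      push_cast
      field_simp
      ring
    rw [h4, mul_add]
    have h5 : y / ((m : ℝ) + 1 + y) = y * (1 / (m + 1 + y)) := by ring
    have h6 := mul_le_mul_of_nonneg_left h3 hy
    linarith

/-- Going from m + 1 to K (m + 1) vertices, the product is K ^ y up to factors independent of m and
K; this uniformity lets one K serve every block. -/
lemma log_growth_block_le {y : ℝ} (hy : 0 ≤ y) {K m : ℕ} (hK : 0 < K) (hm : 0 < m) :
    Real.log (growth y m ((K - 1) * (m + 1))) ≤ y * (Real.log K + Real.log 2) := by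
  refine (log_growth_le hy _ m hm).trans (mul_le_mul_of_nonneg_left ?_ hy)
  have hm' : (1 : ℝ) ≤ m := by exact_mod_cast hm
  have hK' : (1 : ℝ) ≤ K := by exact_mod_cast hK
  rw [← Real.log_mul (by positivity) two_ne_zero]
  refine Real.log_le_log (by positivity) ?_
  rw [div_le_iff₀ (by positivity), Nat.cast_mul, Nat.cast_sub hK]
  push_cast
  nlinarith

lemma le_log_growth_block {y : ℝ} (hy : 0 ≤ y) {K : ℕ} (hK : 0 < K) (m : ℕ) :
    y * (Real.log K - Real.log (1 + y)) ≤ Real.log (growth y m ((K - 1) * (m + 1))) := by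
  refine le_trans (mul_le_mul_of_nonneg_left ?_ hy) (le_log_growth hy _ m)
  have hK' : (1 : ℝ) ≤ K := by exact_mod_cast hK
  have hm' : (0 : ℝ) ≤ m := Nat.cast_nonneg m
  rw [← Real.log_div (by positivity) (by positivity)]
  refine Real.log_le_log (by positivity) ?_
  rw [div_le_div_iff₀ (by positivity) (by positivity), Nat.cast_mul, Nat.cast_sub hK]
  push_cast
  nlinarith [mul_nonneg (mul_nonneg (by linarith : (0 : ℝ) ≤ K) hm') hy, mul_nonneg hy hy]

/-! ### Comparison of thresholds across a block -/

section comparison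

variable {p α B : ℝ} {f : ℝ → ℝ}

lemma backStep_ge (hp : p ∈ Set.Ioo (0 : ℝ) 1) (hα : 0 ≤ α) (hf : IsProfile B f)
    {θ₀ θ₁ θ₂ c₀ c₁ c₂ h : ℝ} (h₀ : 0 < θ₀) (h₁ : 0 < θ₁) (h₂ : 0 < θ₂)
    (hle : ∀ x, c₀ * Real.exp (θ₀ * (x - h)) - c₁ * Real.exp (θ₁ * (x - h)) -
      c₂ * Real.exp (θ₂ * (x - h)) ≤ f x) (m : ℕ) (x : ℝ) :
    (1 + α * mgfStep p θ₀ / (m + 1)) * c₀ * Real.exp (θ₀ * (x - h)) -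
      (1 + α * mgfStep p θ₁ / (m + 1)) * c₁ * Real.exp (θ₁ * (x - h)) -
      (1 + α * mgfStep p θ₂ / (m + 1)) * c₂ * Real.exp (θ₂ * (x - h)) ≤ backStep α p m f x := by
  have hs := (((hasSum_geoMass_mul_exp hp h₀ (x - h)).mul_left c₀).sub
    ((hasSum_geoMass_mul_exp hp h₁ (x - h)).mul_left c₁)).sub
    ((hasSum_geoMass_mul_exp hp h₂ (x - h)).mul_left c₂)
  have hP := hasSum_le (fun k => ?_) hs (hf.hasSum hp x)
  · have ha : 0 ≤ α / ((m : ℝ) + 1) := by positivity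
    have h3 := mul_le_mul_of_nonneg_left hP ha
    have h4 := hle x
    rw [backStep]
    calc _ = (c₀ * Real.exp (θ₀ * (x - h)) - c₁ * Real.exp (θ₁ * (x - h)) -
              c₂ * Real.exp (θ₂ * (x - h))) + α / ((m : ℝ) + 1) *
            (c₀ * (mgfStep p θ₀ * Real.exp (θ₀ * (x - h))) -
              c₁ * (mgfStep p θ₁ * Real.exp (θ₁ * (x - h))) -
              c₂ * (mgfStep p θ₂ * Real.exp (θ₂ * (x - h)))) := by ring
      _ ≤ _ := add_le_add h4 h3
  · have h5 := mul_le_mul_of_nonneg_left (hle (x + 1 - k)) (geoMass_nonneg hp k)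
    rw [show x - h + 1 - (k : ℝ) = x + 1 - k - h by ring]
    linarith

lemma back_ge (hp : p ∈ Set.Ioo (0 : ℝ) 1) (hα : α ∈ Set.Icc (0 : ℝ) 1) (hf : IsProfile B f)
    {θ₀ θ₁ θ₂ c₀ c₁ c₂ h : ℝ} (h₀ : 0 < θ₀) (h₁ : 0 < θ₁) (h₂ : 0 < θ₂)
    (hle : ∀ x, c₀ * Real.exp (θ₀ * (x - h)) - c₁ * Real.exp (θ₁ * (x - h)) -
      c₂ * Real.exp (θ₂ * (x - h)) ≤ f x) (k : ℕ) : ∀ (m : ℕ) (x : ℝ),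
    growth (α * mgfStep p θ₀) m k * c₀ * Real.exp (θ₀ * (x - h)) -
      growth (α * mgfStep p θ₁) m k * c₁ * Real.exp (θ₁ * (x - h)) -
      growth (α * mgfStep p θ₂) m k * c₂ * Real.exp (θ₂ * (x - h)) ≤ back α p m k f x := by
  induction k with
  | zero =>
    intro m x
    simpa [growth, back] using hle x
  | succ k ih =>
    intro m x
    have h := backStep_ge hp hα.1 (hf.back hp hα k (m + 1)) h₀ h₁ h₂ (ih (m + 1)) m x
    simp only [← mul_assoc] at h
    exact h

/-- The function `lam` times the indicator of `[h, ∞)`. -/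
noncomputable def threshold (lam h x : ℝ) : ℝ := if h ≤ x then lam else 0

lemma isProfile_threshold {lam : ℝ} (hlam : 0 ≤ lam) (h : ℝ) : IsProfile lam (threshold lam h) := by
  refine ⟨fun x y hxy => ?_, fun x => ?_⟩
  · unfold threshold
    split_ifs <;> first | exact le_rfl | exact hlam | (exfalso; linarith)
  · unfold threshold
    split_ifs <;> simp [hlam]

/-- A minorant made of eigenfunctions. Left of h + a the (θ - η) term cancels the main one; right of
h + b the (θ + η) term does; in between the main term is at most lam by its normalisation at h + b.
-/
lemma exp_comb_le_threshold {lam : ℝ} (hlam : 0 ≤ lam) {θ η : ℝ} (hη : 0 ≤ η) (hθ : 0 ≤ θ)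
    (a b h x : ℝ) :
    lam * Real.exp (-(θ * b)) * Real.exp (θ * (x - h)) -
      lam * Real.exp (-(θ * b) + η * a) * Real.exp ((θ - η) * (x - h)) -
      lam * Real.exp (-(θ * b) - η * b) * Real.exp ((θ + η) * (x - h)) ≤
    threshold lam (h + a) x := by
  simp only [mul_assoc, ← Real.exp_add, ← mul_sub]
  have e1 := (Real.exp_pos (-(θ * b) + θ * (x - h))).le
  have e2 := (Real.exp_pos (-(θ * b) + η * a + (θ - η) * (x - h))).le
  have e3 := (Real.exp_pos (-(θ * b) - η * b + (θ + η) * (x - h))).le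
  unfold threshold
  split_ifs with hx
  · refine mul_le_of_le_one_right hlam ?_
    rcases le_total (x - h) b with hb | hb
    · have : Real.exp (-(θ * b) + θ * (x - h)) ≤ 1 := by
        rw [Real.exp_le_one_iff]
        nlinarith
      linarith
    · have : Real.exp (-(θ * b) + θ * (x - h)) ≤
          Real.exp (-(θ * b) - η * b + (θ + η) * (x - h)) := by
        rw [Real.exp_le_exp]
        nlinarith
      linarith
  · refine mul_nonpos_of_nonneg_of_nonpos hlam ?_
    have : Real.exp (-(θ * b) + θ * (x - h)) ≤
        Real.exp (-(θ * b) + η * a + (θ - η) * (x - h)) := by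
      rw [Real.exp_le_exp]
      have : x - h ≤ a := by linarith
      nlinarith
    linarith

lemma eventually_three_exp_le {A₀ A₁ A₂ A₃ : ℝ} (h₁ : A₁ < A₀) (h₂ : A₂ < A₀) (h₃ : A₃ < A₀)
    (B₀ B₁ B₂ B₃ : ℝ) : ∀ᶠ L in atTop, Real.exp (A₁ * L + B₁) + Real.exp (A₂ * L + B₂) +
      Real.exp (A₃ * L + B₃) ≤ Real.exp (A₀ * L + B₀) := by
  have key : ∀ A C : ℝ, A < A₀ → ∀ᶠ L in atTop,
      Real.exp (A * L + C) ≤ Real.exp (A₀ * L + B₀) / 3 := by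
    intro A C hA
    filter_upwards [eventually_ge_atTop ((C + Real.log 3 - B₀) / (A₀ - A))] with L hL
    rw [div_le_iff₀ (by linarith)] at hL
    rw [le_div_iff₀ (by norm_num)]
    calc Real.exp (A * L + C) * 3 = Real.exp (A * L + C + Real.log 3) := by
          rw [Real.exp_add _ (Real.log 3), Real.exp_log (by norm_num)]
      _ ≤ _ := Real.exp_le_exp.2 (by linarith)
  filter_upwards [key A₁ B₁ h₁, key A₂ B₂ h₂, key A₃ B₃ h₃] with L l1 l2 l3
  linarith

/-- With L = log K, a = c₁ L and b = c₂ L, pulling the minorant back gives each term at x = h a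
power of K. `h1` and `h2` make both subtracted powers smaller than the main one, and `h3` makes the
main one exceed the normalisation K ^ (θ c₂). -/
lemma exists_block (hp : p ∈ Set.Ioo (0 : ℝ) 1) (hα : α ∈ Set.Icc (0 : ℝ) 1) {θ η c₁ c₂ : ℝ}
    (hη : 0 < η) (hηθ : η < θ) (h1 : η * c₁ + α * mgfStep p (θ - η) < α * mgfStep p θ)
    (h2 : α * mgfStep p (θ + η) - η * c₂ < α * mgfStep p θ) (h3 : θ * c₂ < α * mgfStep p θ) :
    ∃ K : ℕ, 2 ≤ K ∧ ∀ (lam : ℝ), 0 ≤ lam → ∀ (m : ℕ), 0 < m → ∀ h x : ℝ,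
      threshold lam h x ≤
        back α p m ((K - 1) * (m + 1)) (threshold lam (h + c₁ * Real.log K)) x := by
  have p0 := mgfStep_pos hp (show 0 < θ by linarith)
  have p1 := mgfStep_pos hp (show 0 < θ - η by linarith)
  have p2 := mgfStep_pos hp (show 0 < θ + η by linarith)
  set y₀ := α * mgfStep p θ with hy₀
  set y₁ := α * mgfStep p (θ - η) with hy₁
  set y₂ := α * mgfStep p (θ + η) with hy₂
  have q0 : 0 ≤ y₀ := mul_nonneg hα.1 p0.le
  have q1 : 0 ≤ y₁ := mul_nonneg hα.1 p1.le
  have q2 : 0 ≤ y₂ := mul_nonneg hα.1 p2.le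
  have hev := eventually_three_exp_le h3 h1 h2 (-(y₀ * Real.log (1 + y₀))) 0 (y₁ * Real.log 2)
    (y₂ * Real.log 2)
  obtain ⟨K, hK, hK2⟩ := (((Real.tendsto_log_atTop.comp
    (tendsto_natCast_atTop_atTop (R := ℝ))).eventually hev).and (eventually_ge_atTop 2)).exists
  refine ⟨K, hK2, fun lam hlam m hm h x => ?_⟩
  simp only [Function.comp_apply] at hK
  set L := Real.log K with hL
  set k := (K - 1) * (m + 1) with hk
  have hprof := (isProfile_threshold hlam (h + c₁ * L)).back hp hα k m
  unfold threshold
  split_ifs with hx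
  swap
  · exact (hprof.2 x).1
  -- By monotonicity it suffices to take x = h, where all exponentials in x - h equal 1.
  refine le_trans ?_ (hprof.1 hx)
  have hb := back_ge hp hα (isProfile_threshold hlam (h + c₁ * L)) (show 0 < θ by linarith)
    (show 0 < θ - η by linarith) (show 0 < θ + η by linarith)
    (exp_comb_le_threshold hlam hη.le (by linarith) (c₁ * L) (c₂ * L) h) k m h
  refine le_trans ?_ hb
  simp only [sub_self, mul_zero, Real.exp_zero, mul_one]
  rw [← hy₀, ← hy₁, ← hy₂]
  have g0 : Real.exp (y₀ * L + -(y₀ * Real.log (1 + y₀))) ≤ growth y₀ m k := by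
    rw [← Real.le_log_iff_exp_le (growth_pos q0 _ _)]
    refine le_trans (le_of_eq ?_) (le_log_growth_block q0 (by omega) m)
    ring
  have g1 : growth y₁ m k ≤ Real.exp (y₁ * L + y₁ * Real.log 2) := by
    rw [← Real.log_le_iff_le_exp (growth_pos q1 _ _)]
    refine (log_growth_block_le q1 (by omega) hm).trans (le_of_eq ?_)
    ring
  have g2 : growth y₂ m k ≤ Real.exp (y₂ * L + y₂ * Real.log 2) := by
    rw [← Real.log_le_iff_le_exp (growth_pos q2 _ _)]
    refine (log_growth_block_le q2 (by omega) hm).trans (le_of_eq ?_)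
    ring
  have e1 : Real.exp ((η * c₁ + y₁) * L + y₁ * Real.log 2) =
      Real.exp (η * (c₁ * L)) * Real.exp (y₁ * L + y₁ * Real.log 2) := by
    rw [← Real.exp_add]
    ring_nf
  have e2 : Real.exp ((y₂ - η * c₂) * L + y₂ * Real.log 2) =
      Real.exp (-(η * (c₂ * L))) * Real.exp (y₂ * L + y₂ * Real.log 2) := by
    rw [← Real.exp_add]
    ring_nf
  have e3 : Real.exp (θ * c₂ * L + 0) = Real.exp (θ * (c₂ * L)) := by ring_nf
  rw [e1, e2, e3] at hK
  have s1 := mul_le_mul_of_nonneg_left g1 (Real.exp_pos (η * (c₁ * L))).le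
  have s2 := mul_le_mul_of_nonneg_left g2 (Real.exp_pos (-(η * (c₂ * L)))).le
  have main : Real.exp (θ * (c₂ * L)) ≤ growth y₀ m k - Real.exp (η * (c₁ * L)) * growth y₁ m k -
      Real.exp (-(η * (c₂ * L))) * growth y₂ m k := by linarith
  have hE := mul_le_mul_of_nonneg_left main
    (mul_nonneg hlam (Real.exp_pos (-(θ * (c₂ * L)))).le)
  rw [mul_assoc, ← Real.exp_add, neg_add_cancel, Real.exp_zero, mul_one] at hE
  rw [sub_eq_add_neg (-(θ * (c₂ * L))), Real.exp_add, Real.exp_add]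
  linarith

end comparison

/-! ### The lower bound on the height -/

section lowerTail

variable {p α : ℝ}

/-- The Laplace transform at `lam` of the number of vertices of depth at least `h`. -/
noncomputable def laplaceCount (p : unitInterval) (lam h : ℝ) (m : ℕ) : ENNReal :=
  expect (depths p m) fun δ => ENNReal.ofReal (Real.exp (-∑ v, threshold lam h (δ v)))

lemma laplaceCount_zero (p : unitInterval) (lam : ℝ) (m : ℕ) :
    laplaceCount p lam 0 m = ENNReal.ofReal (Real.exp (-((m + 1) * lam))) := by
  have : ∀ δ : Fin (m + 1) → ℕ, ∑ v, threshold lam 0 (δ v) = (m + 1) * lam := by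
    intro δ
    simp [threshold]
  simp only [laplaceCount, this, expect_const]

lemma map_sup_lt_le_laplaceCount (p : unitInterval) (lam : ℝ) {h : ℝ} {S : Set ℕ}
    (hS : ∀ k ∈ S, (k : ℝ) < h) (m : ℕ) :
    ((depths p m).map fun δ => Finset.univ.sup δ).toMeasure S ≤ laplaceCount p lam h m := by
  refine toMeasure_map_le_expect _ _ _ fun δ hδ => ?_
  have : ∑ v, threshold lam h (δ v) = 0 := by
    refine Finset.sum_eq_zero fun v _ => ?_
    have hv : ((δ v : ℕ) : ℝ) ≤ (Finset.univ.sup δ : ℕ) := by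
      exact_mod_cast Finset.le_sup (f := δ) (Finset.mem_univ v)
    rw [threshold, if_neg (not_le.2 (hv.trans_lt (hS _ hδ)))]
  rw [this, neg_zero, Real.exp_zero, ENNReal.ofReal_one]

/-- Since exp(-y) ≤ 1/(1 + y), it suffices that (1 - α y)(1 + y) ≥ 1, that is y (1 - α - α y) ≥ 0.
-/
lemma exp_neg_le_one_sub_mul (hα : α ∈ Set.Icc (0 : ℝ) 1) {y : ℝ} (h0 : 0 ≤ y) (h1 : y ≤ 1 - α) :
    Real.exp (-y) ≤ 1 - α * y := by
  have h2 := Real.add_one_le_exp y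
  rw [Real.exp_neg, inv_le_iff_one_le_mul₀ (Real.exp_pos y)]
  have h3 : 0 ≤ 1 - α * y := by nlinarith [hα.1, hα.2]
  refine le_trans ?_ (mul_le_mul_of_nonneg_left h2 h3)
  have h4 : 0 ≤ 1 - α - α * y := by nlinarith [hα.1, hα.2]
  nlinarith [mul_nonneg h0 h4]

/-- This covers the sizes lying between consecutive values K ^ r * t. -/
lemma laplaceCount_antitone (hp : p ∈ Set.Ioo (0 : ℝ) 1) (hα : α ∈ Set.Icc (0 : ℝ) 1) {lam : ℝ}
    (hlam : 0 ≤ lam) (hlam1 : lam ≤ 1 - α) (h : ℝ) :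
    Antitone (laplaceCount ⟨p, Set.Ioo_subset_Icc_self hp⟩ lam h) := by
  refine antitone_nat_of_succ_le fun m => ?_
  have hprof := isProfile_threshold hlam h
  refine (expect_exp_neg_succ_le hp hprof
    (fun y h0 h1 => exp_neg_le_one_sub_mul hα h0 (h1.trans hlam1)) m).trans
    (expect_mono _ fun δ => ENNReal.ofReal_le_ofReal (Real.exp_le_exp.2 (neg_le_neg
      (Finset.sum_le_sum fun v _ => ?_))))
  exact le_add_of_nonneg_right
    (mul_nonneg (div_nonneg hα.1 (by positivity)) ((hprof.stepAverage hp).2 _).1)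

/-- Each block trades a factor K in size for a shift a of the threshold. At threshold 0 all t
initial vertices count, whence the bound. The index is the number of vertices minus one, and t ≥ 2
keeps it positive, as `hblock` requires. -/
lemma laplaceCount_iterate (hp : p ∈ Set.Ioo (0 : ℝ) 1) (hα : α ∈ Set.Icc (0 : ℝ) 1) {a : ℝ}
    {K : ℕ} (hK : 0 < K) {lam : ℝ} (hlam : 0 ≤ lam) (hlamK : lam * K ≤ 1 - α)
    (hblock : ∀ m : ℕ, 0 < m → ∀ h x : ℝ, threshold lam h x ≤
      back α p m ((K - 1) * (m + 1)) (threshold lam (h + a)) x) {t : ℕ} (ht : 2 ≤ t) (r : ℕ) :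
    laplaceCount ⟨p, Set.Ioo_subset_Icc_self hp⟩ lam (r * a) (K ^ r * t - 1) ≤
      ENNReal.ofReal (Real.exp (-(t * lam))) := by
  induction r with
  | zero =>
    rw [Nat.cast_zero, zero_mul, pow_zero, one_mul, laplaceCount_zero]
    have : ((t - 1 : ℕ) : ℝ) + 1 = t := by
      rw [Nat.cast_sub (by omega)]
      simp
    rw [this]
  | succ r ih =>
    refine le_trans ?_ ih
    have hpow : t ≤ K ^ r * t := Nat.le_mul_of_pos_left t (by positivity)
    obtain ⟨m, hm⟩ : ∃ m, K ^ r * t = m + 1 := ⟨K ^ r * t - 1, by omega⟩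
    have hm1 : 0 < m := by omega
    have hidx : K ^ (r + 1) * t - 1 = m + (K - 1) * (m + 1) := by
      obtain ⟨K', rfl⟩ : ∃ K', K = K' + 1 := ⟨K - 1, by omega⟩
      rw [pow_succ, mul_assoc, mul_comm (K' + 1) t, ← mul_assoc, hm, Nat.add_sub_cancel]
      have : (m + 1) * (K' + 1) = m + K' * (m + 1) + 1 := by ring
      omega
    rw [hidx, hm, Nat.add_sub_cancel]
    have hB : lam * (((m : ℝ) + ((K - 1) * (m + 1) : ℕ) + 1) / (m + 1)) = lam * K := by
      congr 1
      rw [Nat.cast_mul, Nat.cast_sub hK]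
      push_cast
      field_simp
      ring
    have h1 := expect_exp_neg_back_le hp hα hlam (isProfile_threshold hlam ((r + 1 : ℕ) * a))
      ((K - 1) * (m + 1)) m (fun y h0 h1 => exp_neg_le_one_sub_mul hα h0
        (h1.trans (hB.le.trans hlamK)))
    refine h1.trans (expect_mono _ fun δ => ENNReal.ofReal_le_ofReal (Real.exp_le_exp.2
      (neg_le_neg (Finset.sum_le_sum fun v _ => ?_))))
    have h2 := hblock m hm1 (r * a) (δ v)
    rwa [show (r : ℝ) * a + a = ((r + 1 : ℕ) : ℝ) * a by push_cast; ring] at h2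

theorem tendsto_lowerTail (hp : p ∈ Set.Ioo (0 : ℝ) 1) (hα : α ∈ Set.Ico (0 : ℝ) 1)
    {c c₁ c₂ θ η : ℝ} (hc : c < c₁) (hc₁ : 0 ≤ c₁) (hη : 0 < η) (hηθ : η < θ)
    (h1 : η * c₁ + α * mgfStep p (θ - η) < α * mgfStep p θ)
    (h2 : α * mgfStep p (θ + η) - η * c₂ < α * mgfStep p θ) (h3 : θ * c₂ < α * mgfStep p θ) :
    Tendsto (fun m : ℕ => ((depths ⟨p, Set.Ioo_subset_Icc_self hp⟩ m).map
      fun δ => Finset.univ.sup δ).toMeasure {h : ℕ | (h : ℝ) < c * Real.log ((m + 1 : ℕ) : ℝ)})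
      atTop (𝓝 0) := by
  have hα' : α ∈ Set.Icc (0 : ℝ) 1 := Set.Ico_subset_Icc_self hα
  obtain ⟨K, hK2, hblock⟩ := exists_block hp hα' hη hηθ h1 h2 h3
  have hK : (1 : ℝ) < K := by exact_mod_cast hK2
  have hα1 := hα.2
  -- Within a block the pulled-back profile can grow by a factor K, and it must stay below 1 - α.
  set lam := (1 - α) / K with hlam
  have hlam0 : 0 < lam := div_pos (by linarith) (by linarith)
  have hlamK : lam * K = 1 - α := div_mul_cancel₀ _ (by linarith)
  have hlam1 : lam ≤ 1 - α := by nlinarith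
  have hexp : Tendsto (fun t : ℕ => ENNReal.ofReal (Real.exp (-(t * lam)))) atTop (𝓝 0) := by
    rw [← ENNReal.ofReal_zero]
    refine ENNReal.tendsto_ofReal (Real.tendsto_exp_neg_atTop_nhds_zero.comp ?_)
    exact tendsto_natCast_atTop_atTop.atTop_mul_const hlam0
  rw [ENNReal.tendsto_nhds_zero] at hexp ⊢
  intro e he
  -- The initial size t is fixed by the target error alone; the cost (log t + log K) c₁ of the start
  -- and of rounding r is absorbed by the gap c₁ - c for large m.
  obtain ⟨t, hte, ht2⟩ := ((hexp e he).and (eventually_ge_atTop 2)).exists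
  have hlog : Tendsto (fun m : ℕ => Real.log ((m + 1 : ℕ) : ℝ)) atTop atTop :=
    Real.tendsto_log_atTop.comp (tendsto_natCast_atTop_atTop.comp (tendsto_add_atTop_nat 1))
  filter_upwards [eventually_ge_atTop t, hlog.eventually_gt_atTop
    (c₁ * (Real.log t + Real.log K) / (c₁ - c))] with m hm hm2
  rw [div_lt_iff₀ (by linarith)] at hm2
  set r := Nat.log K ((m + 1) / t) with hr
  have ht0 : 0 < t := by omega
  have hdiv : (m + 1) / t ≠ 0 := (Nat.div_pos (by omega) ht0).ne'
  have hle : K ^ r * t ≤ m + 1 := (Nat.le_div_iff_mul_le ht0).1 (Nat.pow_log_le_self K hdiv)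
  have hlt : m + 1 < K ^ (r + 1) * t :=
    (Nat.div_lt_iff_lt_mul ht0).1 (Nat.lt_pow_succ_log_self (by omega) _)
  have hlogm : Real.log ((m + 1 : ℕ) : ℝ) ≤ (r + 1) * Real.log K + Real.log t := by
    have ht' : (0 : ℝ) < t := by exact_mod_cast ht0
    have : (((m + 1 : ℕ) : ℝ)) ≤ (K : ℝ) ^ (r + 1) * t := by exact_mod_cast hlt.le
    refine (Real.log_le_log (by positivity) this).trans (le_of_eq ?_)
    rw [Real.log_mul (by positivity) (by positivity), Real.log_pow]
    push_cast
    ring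
  have hcut : c * Real.log ((m + 1 : ℕ) : ℝ) ≤ r * (c₁ * Real.log K) := by
    have := mul_le_mul_of_nonneg_left hlogm hc₁
    nlinarith
  refine (map_sup_lt_le_laplaceCount _ lam (h := r * (c₁ * Real.log K))
    (fun k hk => lt_of_lt_of_le hk hcut) m).trans ?_
  refine (laplaceCount_antitone hp hα' hlam0.le hlam1 _ (show K ^ r * t - 1 ≤ m by omega)).trans ?_
  exact (laplaceCount_iterate hp hα' (by omega) hlam0.le hlamK.le (hblock lam hlam0.le) ht2
    r).trans hte

end lowerTail

/-! ### The upper bound on the height -/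

section upperTail

variable {p θ : ℝ}

lemma expect_sum_exp_succ_le (hp : p ∈ Set.Ioo (0 : ℝ) 1) (hθ : 0 < θ) {m : ℕ}
    (δ : Fin (m + 1) → ℕ) :
    expect (depthStep ⟨p, Set.Ioo_subset_Icc_self hp⟩ δ)
        (fun δ' => ENNReal.ofReal (∑ v, Real.exp (θ * δ' v))) ≤
      ENNReal.ofReal ((1 + mgfStep p θ / (m + 1)) * (∑ v, Real.exp (θ * δ v)) + Real.exp θ) := by
  set Z := ∑ v, Real.exp (θ * δ v) with hZ
  have hZ0 : 0 ≤ Z := Finset.sum_nonneg fun v _ => (Real.exp_pos _).le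
  refine (expect_depthStep_le hp δ (F := fun δ' => ∑ v, Real.exp (θ * δ' v))
    -- The new vertex has depth δ u + 1 - k, or depth 1 after truncation; the sum of the two
    -- exponentials covers both cases.
    (B := fun u k => (Z + Real.exp θ) + Real.exp (θ * ((δ u : ℝ) + 1 - k)))
    (S := fun u => (Z + Real.exp θ) + mgfStep p θ * Real.exp (θ * δ u)) ?_ ?_ ?_).trans
      (ENNReal.ofReal_le_ofReal (le_of_eq ?_))
  · intro u k
    rw [sum_snoc (fun x => Real.exp (θ * x)), add_assoc]
    refine add_le_add le_rfl ?_
    rcases le_total k (δ u) with hk | hk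
    · rw [Nat.cast_add, Nat.cast_sub hk, Nat.cast_one,
        show (δ u : ℝ) - k + 1 = δ u + 1 - k by ring]
      exact le_add_of_nonneg_left (Real.exp_pos _).le
    · rw [Nat.sub_eq_zero_of_le hk]
      simpa using (Real.exp_pos _).le
  · intro u k
    positivity
  · intro u
    have h := ((hasSum_geoMass hp).mul_right (Z + Real.exp θ)).add
      (hasSum_geoMass_mul_exp hp hθ (δ u))
    convert! h using 1
    · funext k
      ring
    · ring
  · rw [Finset.sum_add_distrib, ← Finset.mul_sum, ← hZ]
    simp only [Finset.sum_const, Finset.card_univ, Fintype.card_fin, nsmul_eq_mul]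
    push_cast
    field_simp
    ring

/-- By Bernoulli, C n ^ y grows in one step by at least C y n ^ (y - 1). The part with φ feeds the
recursion, and the remaining C (y - φ) n ^ (y - 1) absorbs the additive exp θ because y ≥ 1. -/
lemma expect_sum_exp_le (hp : p ∈ Set.Ioo (0 : ℝ) 1) (hθ : 0 < θ) {y C : ℝ} (hy : 1 ≤ y)
    (hC1 : 1 ≤ C) (hC : Real.exp θ ≤ C * (y - mgfStep p θ)) (m : ℕ) :
    expect (depths ⟨p, Set.Ioo_subset_Icc_self hp⟩ m)
        (fun δ => ENNReal.ofReal (∑ v, Real.exp (θ * δ v))) ≤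
      ENNReal.ofReal (C * ((m : ℝ) + 1) ^ y) := by
  induction m with
  | zero =>
    rw [depths, expect_pure]
    refine ENNReal.ofReal_le_ofReal ?_
    simpa using hC1
  | succ m ih =>
    have hφ := mgfStep_pos hp hθ
    rw [depths, expect_bind]
    refine (expect_mono _ fun δ => expect_sum_exp_succ_le hp hθ δ).trans ?_
    have hrw : ∀ δ : Fin (m + 1) → ℕ, ENNReal.ofReal ((1 + mgfStep p θ / (m + 1)) *
        (∑ v, Real.exp (θ * δ v)) + Real.exp θ) =
        ENNReal.ofReal (1 + mgfStep p θ / (m + 1)) * ENNReal.ofReal (∑ v, Real.exp (θ * δ v)) +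
          ENNReal.ofReal (Real.exp θ) := by
      intro δ
      rw [ENNReal.ofReal_add (by positivity) (Real.exp_pos _).le,
        ENNReal.ofReal_mul (by positivity)]
    simp only [hrw]
    rw [expect_add, expect_const_mul, expect_const]
    refine (add_le_add (mul_le_mul_right ih _) le_rfl).trans ?_
    have hx : (0 : ℝ) < (m : ℝ) + 1 := by positivity
    rw [← ENNReal.ofReal_mul (by positivity), ← ENNReal.ofReal_add (by positivity)
      (Real.exp_pos _).le]
    refine ENNReal.ofReal_le_ofReal ?_
    have hbern := one_add_mul_self_le_rpow_one_add
      (s := 1 / ((m : ℝ) + 1)) (by have : 0 < 1 / ((m : ℝ) + 1) := by positivity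
                                   linarith) hy
    have hpow : ((m + 1 : ℕ) + 1 : ℝ) ^ y =
        ((m : ℝ) + 1) ^ y * (1 + 1 / ((m : ℝ) + 1)) ^ y := by
      rw [← Real.mul_rpow (by positivity) (by positivity)]
      congr 1
      push_cast
      field_simp
    rw [hpow]
    have hX : (m : ℝ) + 1 ≤ ((m : ℝ) + 1) ^ y := by
      have := Real.rpow_le_rpow_of_exponent_le (show 1 ≤ (m : ℝ) + 1 by
        linarith [(Nat.cast_nonneg m : (0 : ℝ) ≤ m)]) hy
      rwa [Real.rpow_one] at this
    set X := ((m : ℝ) + 1) ^ y with hXdef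
    have hX0 : 0 < X := by positivity
    have h1 : C * (X * (1 + y * (1 / ((m : ℝ) + 1)))) ≤
        C * (X * (1 + 1 / ((m : ℝ) + 1)) ^ y) := by gcongr
    refine le_trans ?_ h1
    have hgap : 0 ≤ C * (y - mgfStep p θ) := (Real.exp_pos θ).le.trans hC
    have h2 : C * (y - mgfStep p θ) ≤ C * (y - mgfStep p θ) * (X / (m + 1)) :=
      le_mul_of_one_le_right hgap ((one_le_div hx).2 hX)
    have h3 : C * (X * (1 + y * (1 / ((m : ℝ) + 1)))) =
        (1 + mgfStep p θ / (m + 1)) * (C * X) + C * (y - mgfStep p θ) * (X / (m + 1)) := by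
      field_simp
      ring
    linarith

theorem tendsto_upperTail (hp : p ∈ Set.Ioo (0 : ℝ) 1) (hθ : 0 < θ) (h1 : 1 ≤ mgfStep p θ)
    {c : ℝ} (hc : mgfStep p θ / θ < c) :
    Tendsto (fun m : ℕ => ((depths ⟨p, Set.Ioo_subset_Icc_self hp⟩ m).map
      fun δ => Finset.univ.sup δ).toMeasure {h : ℕ | c * Real.log ((m + 1 : ℕ) : ℝ) < (h : ℝ)})
      atTop (𝓝 0) := by
  rw [div_lt_iff₀ hθ] at hc
  set φ := mgfStep p θ with hφ
  obtain ⟨y, hy1, hy2⟩ := exists_between hc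
  set C := max 1 (Real.exp θ / (y - φ)) with hCdef
  have hC : Real.exp θ ≤ C * (y - φ) := by
    rw [← div_le_iff₀ (by linarith)]
    exact le_max_right _ _
  have hC1 : 1 ≤ C := le_max_left _ _
  have hC0 : 0 < C := lt_of_lt_of_le one_pos hC1
  clear_value C
  have hbound : ∀ m : ℕ, ((depths ⟨p, Set.Ioo_subset_Icc_self hp⟩ m).map
      fun δ => Finset.univ.sup δ).toMeasure {h : ℕ | c * Real.log ((m + 1 : ℕ) : ℝ) < (h : ℝ)} ≤
      ENNReal.ofReal (C * ((m + 1 : ℕ) : ℝ) ^ (-(c * θ - y))) := by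
    intro m
    have hm : (0 : ℝ) < ((m + 1 : ℕ) : ℝ) := by positivity
    set E := Real.exp (θ * (c * Real.log ((m + 1 : ℕ) : ℝ))) with hE
    have hE0 : 0 < E := Real.exp_pos _
    refine (toMeasure_map_le_expect _ _ _ (F := fun δ => ENNReal.ofReal E⁻¹ *
      ENNReal.ofReal (∑ v, Real.exp (θ * δ v))) fun δ hδ => ?_).trans ?_
    · rw [← ENNReal.ofReal_mul (by positivity), ← ENNReal.ofReal_one]
      refine ENNReal.ofReal_le_ofReal ?_
      obtain ⟨v, -, hv⟩ := Finset.exists_mem_eq_sup (Finset.univ : Finset (Fin (m + 1)))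
        Finset.univ_nonempty δ
      rw [Set.mem_ofPred_eq, hv] at hδ
      rw [inv_mul_eq_div, one_le_div hE0]
      refine le_trans ?_ (Finset.single_le_sum (f := fun v => Real.exp (θ * δ v))
        (fun v _ => (Real.exp_pos _).le) (Finset.mem_univ v))
      exact Real.exp_le_exp.2 (mul_le_mul_of_nonneg_left hδ.le hθ.le)
    · rw [expect_const_mul]
      refine (mul_le_mul_right (expect_sum_exp_le hp hθ (by linarith) hC1 hC m)
        _).trans ?_
      rw [← ENNReal.ofReal_mul (by positivity)]
      refine ENNReal.ofReal_le_ofReal (le_of_eq ?_)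
      have e1 : E = ((m + 1 : ℕ) : ℝ) ^ (c * θ) := by
        rw [Real.rpow_def_of_pos hm, hE]
        congr 1
        ring
      rw [e1, neg_sub, Real.rpow_sub hm]
      push_cast
      field_simp
  refine tendsto_of_tendsto_of_tendsto_of_le_of_le tendsto_const_nhds ?_ (fun _ => zero_le) hbound
  rw [← ENNReal.ofReal_zero]
  refine ENNReal.tendsto_ofReal ?_
  have := (tendsto_rpow_neg_atTop (show 0 < c * θ - y by linarith)).comp
    (tendsto_natCast_atTop_atTop.comp (tendsto_add_atTop_nat 1))
  simpa using this.const_mul C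

end upperTail

/-! ### The constants s, p₀, `cL` and the choice of parameters -/

section constants

lemma isS_iff {p s : ℝ} : IsS p s ↔
    s ∈ Set.Ioo (0 : ℝ) 1 ∧ Real.log ((1 - p) * (2 - s) / (1 - s)) = 1 / s := by
  refine and_congr_right fun hs => ?_
  rw [eq_div_iff hs.1.ne', mul_comm]

lemma strictMonoOn_log_sub_inv {p : ℝ} (hp : p ∈ Set.Ioo (0 : ℝ) 1) :
    StrictMonoOn (fun s : ℝ => Real.log ((1 - p) * (2 - s) / (1 - s)) - 1 / s)
      (Set.Ioo (0 : ℝ) 1) := by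
  intro s hs t ht hst
  have hp1 : 0 < 1 - p := by linarith [hp.2]
  have hs1 : 0 < 1 - s := by linarith [hs.2]
  have ht1 : 0 < 1 - t := by linarith [ht.2]
  have hs2 : 0 < 2 - s := by linarith
  have h1 : Real.log ((1 - p) * (2 - s) / (1 - s)) < Real.log ((1 - p) * (2 - t) / (1 - t)) := by
    refine Real.log_lt_log (by positivity) ?_
    rw [div_lt_div_iff₀ hs1 ht1]
    nlinarith
  have h2 : 1 / t < 1 / s := one_div_lt_one_div_of_lt hs.1 hst
  simp only
  linarith

theorem existsUnique_isS {p : ℝ} (hp : p ∈ Set.Ioo (0 : ℝ) 1) : ∃! s, IsS p s := by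
  have hp1 : 0 < 1 - p := by linarith [hp.2]
  set g : ℝ → ℝ := fun s => Real.log ((1 - p) * (2 - s) / (1 - s)) - 1 / s with hg
  -- With this b the logarithm's argument is exp 2 * (2 - b) ≥ exp 2, while 1 / b ≤ 2 because b >
  -- 1/2.
  set b : ℝ := 1 - (1 - p) * Real.exp (-2) with hb
  have he : Real.exp (-2) < 1 / 2 := by
    rw [Real.exp_neg, one_div]
    exact inv_strictAnti₀ two_pos (by linarith [Real.add_one_lt_exp (show (2 : ℝ) ≠ 0 by norm_num)])
  have he0 := Real.exp_pos (-2)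
  have hb1 : b < 1 := by
    have := mul_pos hp1 he0
    linarith
  have hb2 : 1 / 2 < b := by nlinarith [hp.1]
  have hcont : ContinuousOn g (Set.Icc (1 / 2) b) := by
    refine ContinuousOn.sub (ContinuousOn.log (ContinuousOn.div (by fun_prop) (by fun_prop) ?_) ?_)
      (ContinuousOn.div (by fun_prop) (by fun_prop) ?_)
    · intro x hx
      linarith [hx.2]
    · intro x hx
      have h1 : 0 < 1 - x := by linarith [hx.2]
      have h2 : 0 < 2 - x := by linarith
      positivity
    · intro x hx
      linarith [hx.1]
  have hleft : g (1 / 2) ≤ 0 := by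
    have h1 : Real.log ((1 - p) * (2 - 1 / 2) / (1 - 1 / 2)) ≤ 2 := by
      refine (Real.log_le_sub_one_of_pos (by positivity)).trans ?_
      rw [show (1 - p) * (2 - 1 / 2) / (1 - 1 / 2) = 3 * (1 - p) by ring]
      linarith [hp.1]
    simp only [hg]
    linarith
  have hright : 0 ≤ g b := by
    have h1 : 2 ≤ Real.log ((1 - p) * (2 - b) / (1 - b)) := by
      rw [Real.le_log_iff_exp_le (div_pos (mul_pos hp1 (by linarith)) (by linarith)),
        le_div_iff₀ (by linarith)]
      have h2 : Real.exp 2 * (1 - b) = 1 - p := by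
        rw [hb, sub_sub_cancel, mul_left_comm, ← Real.exp_add]
        simp
      rw [h2]
      nlinarith
    have h3 : 1 / b ≤ 2 := by
      rw [div_le_iff₀ (by linarith)]
      linarith
    simp only [hg]
    linarith
  obtain ⟨s, hs, hs0⟩ := intermediate_value_Icc hb2.le hcont ⟨hleft, hright⟩
  have hsI : s ∈ Set.Ioo (0 : ℝ) 1 := ⟨by linarith [hs.1], by linarith [hs.2]⟩
  refine ⟨s, isS_iff.2 ⟨hsI, by simp only [hg] at hs0; linarith⟩, fun t ht => ?_⟩
  replace ht := isS_iff.1 ht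
  refine (strictMonoOn_log_sub_inv hp).injOn ht.1 hsI ?_
  simp only [hg] at hs0
  simp only [hs0, ht.2, sub_self]

lemma strictMonoOn_ratio :
    StrictMonoOn (fun q : ℝ => (1 - q) / (1 - 2 * q)) (Set.Ioo (0 : ℝ) (1 / 2)) := by
  intro q hq r hr hqr
  have h1 : 0 < 1 - 2 * q := by linarith [hq.2]
  have h2 : 0 < 1 - 2 * r := by linarith [hr.2]
  simp only
  rw [div_lt_div_iff₀ h1 h2]
  nlinarith

lemma strictAntiOn_log_sub_ratio :
    StrictAntiOn (fun q : ℝ => Real.log ((1 - q) / q) - (1 - q) / (1 - 2 * q))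
      (Set.Ioo (0 : ℝ) (1 / 2)) := by
  intro q hq r hr hqr
  have h := strictMonoOn_ratio hq hr hqr
  have h1 : Real.log ((1 - r) / r) < Real.log ((1 - q) / q) := by
    refine Real.log_lt_log (div_pos (by linarith [hr.2]) hr.1) ?_
    rw [div_lt_div_iff₀ hr.1 hq.1]
    nlinarith
  simp only at h ⊢
  linarith

/-- The argument of the logarithm is close to 4, so splitting off 2 log 2 leaves a factor near 1 for
which the elementary bound is sharp enough. -/
lemma log_sub_ratio_pos :
    0 < Real.log ((1 - 0.2055) / 0.2055) - (1 - 0.2055) / (1 - 2 * 0.2055 : ℝ) := by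
  have h1 : Real.log ((1 - 0.2055) / 0.2055) = 2 * Real.log 2 + Real.log (1589 / 1644) := by
    rw [two_mul, ← Real.log_mul (by norm_num) (by norm_num),
      ← Real.log_mul (by norm_num) (by norm_num)]
    norm_num
  have h2 := Real.one_sub_inv_le_log_of_pos (show (0 : ℝ) < 1589 / 1644 by norm_num)
  have h3 := Real.log_two_gt_d9
  rw [h1]
  norm_num at h2 h3 ⊢
  linarith

lemma log_sub_ratio_neg :
    Real.log ((1 - 0.2065) / 0.2065) - (1 - 0.2065) / (1 - 2 * 0.2065 : ℝ) < 0 := by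
  have h1 : Real.log ((1 - 0.2065) / 0.2065) = 2 * Real.log 2 + Real.log (1587 / 1652) := by
    rw [two_mul, ← Real.log_mul (by norm_num) (by norm_num),
      ← Real.log_mul (by norm_num) (by norm_num)]
    norm_num
  have h2 := Real.log_le_sub_one_of_pos (show (0 : ℝ) < 1587 / 1652 by norm_num)
  have h3 := Real.log_two_lt_d9
  rw [h1]
  norm_num at h2 h3 ⊢
  linarith

theorem existsUnique_isP0 : ∃! q, IsP0 q := by
  have hcont : ContinuousOn (fun q : ℝ => Real.log ((1 - q) / q) - (1 - q) / (1 - 2 * q))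
      (Set.Icc 0.2055 0.2065) := by
    refine ContinuousOn.sub (ContinuousOn.log (ContinuousOn.div (by fun_prop) (by fun_prop) ?_) ?_)
      (ContinuousOn.div (by fun_prop) (by fun_prop) ?_)
    · intro x hx
      linarith [hx.1]
    · intro x hx
      exact (div_pos (by linarith [hx.2]) (by linarith [hx.1])).ne'
    · intro x hx
      linarith [hx.2]
  obtain ⟨q, hq, hq0⟩ := intermediate_value_Icc' (by norm_num) hcont
    ⟨log_sub_ratio_neg.le, log_sub_ratio_pos.le⟩
  have hqI : q ∈ Set.Ioo (0 : ℝ) (1 / 2) := ⟨by linarith [hq.1], by linarith [hq.2]⟩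
  simp only at hq0
  refine ⟨q, ⟨hqI, by linarith⟩, fun r hr => ?_⟩
  refine strictAntiOn_log_sub_ratio.injOn hr.1 hqI ?_
  simp only [hq0, hr.2, sub_self]

theorem IsP0.abs_sub_lt {q : ℝ} (hq : IsP0 q) : |q - 0.206| < 0.0005 := by
  obtain ⟨hqI, hq0⟩ := hq
  rw [← sub_eq_zero] at hq0
  have h1 : 0.2055 < q := by
    by_contra! h
    have h2 := strictAntiOn_log_sub_ratio.antitoneOn hqI (show (0.2055 : ℝ) ∈ _ by
      constructor <;> norm_num) h
    linarith [log_sub_ratio_pos]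
  have h3 : q < 0.2065 := by
    by_contra! h
    have h2 := strictAntiOn_log_sub_ratio.antitoneOn (show (0.2065 : ℝ) ∈ _ by
      constructor <;> norm_num) hqI h
    linarith [log_sub_ratio_neg]
  rw [abs_lt]
  constructor <;> linarith

variable {p s : ℝ}

lemma IsS.exp_inv (hp : p ∈ Set.Ioo (0 : ℝ) 1) (hs : IsS p s) :
    Real.exp (1 / s) = (1 - p) * (2 - s) / (1 - s) := by
  rw [isS_iff] at hs
  rw [← hs.2, Real.exp_log (div_pos (mul_pos (by linarith [hp.2]) (by linarith [hs.1.2]))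
    (by linarith [hs.1.2]))]

lemma IsS.mul_exp_neg_inv (hp : p ∈ Set.Ioo (0 : ℝ) 1) (hs : IsS p s) :
    (1 - p) * Real.exp (-(1 / s)) = (1 - s) / (2 - s) := by
  have h1 : 1 - p ≠ 0 := by linarith [hp.2]
  have h2 : 2 - s ≠ 0 := by linarith [hs.1.2]
  have h3 : 1 - s ≠ 0 := by linarith [hs.1.2]
  rw [Real.exp_neg, hs.exp_inv hp]
  field_simp

lemma IsS.mgfStep_inv (hp : p ∈ Set.Ioo (0 : ℝ) 1) (hs : IsS p s) :
    mgfStep p (1 / s) = p * Real.exp (1 / s) * (2 - s) := by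
  have h2 : 2 - s ≠ 0 := by linarith [hs.1.2]
  have h3 : 1 - (1 - s) / (2 - s) = 1 / (2 - s) := by
    field_simp
    ring
  rw [mgfStep, hs.mul_exp_neg_inv hp, h3, div_div_eq_mul_div, div_one]

lemma IsS.cL_eq (hp : p ∈ Set.Ioo (0 : ℝ) 1) (hs : IsS p s) :
    cL p s = mgfStep p (1 / s) / (1 / s) := by
  have := hs.1.1.ne'
  rw [hs.mgfStep_inv hp, cL]
  field_simp

/-- Put q = (1 - p) exp(-1/s) = (1 - s)/(2 - s). Then φ(1/s) = p (1 - p)/(q (1 - q)), which is at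
least 1 since q ≤ p and q < 1 - p. The equation for s reads log((1 - p)/q) = (1 - q)/(1 - 2 q); if p
< q, comparing it with the inequality at p that follows from p₀ ≤ p gives a contradiction. -/
lemma IsS.one_le_mgfStep_inv (hp : p ∈ Set.Ioo (0 : ℝ) 1) (hs : IsS p s) {p₀ : ℝ} (hp₀ : IsP0 p₀)
    (hpp : p₀ ≤ p) : 1 ≤ mgfStep p (1 / s) := by
  have h1 : 0 < 1 - s := by linarith [hs.1.2]
  have h2 : 0 < 2 - s := by linarith
  set q := (1 - s) / (2 - s) with hq
  have hq0 : 0 < q := div_pos h1 h2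
  have hq1 : q < 1 / 2 := by
    rw [hq, div_lt_div_iff₀ h2 two_pos]
    linarith [hs.1.1]
  have hexp : Real.exp (1 / s) = (1 - p) / q := by
    rw [hs.exp_inv hp, hq, div_div_eq_mul_div]
  have hratio : (1 - q) / (1 - 2 * q) = 1 / s := by
    have := hs.1.1.ne'
    have e1 : 1 - q = 1 / (2 - s) := by
      rw [hq]
      field_simp
      ring
    have e2 : 1 - 2 * q = s / (2 - s) := by
      rw [hq]
      field_simp
      ring
    rw [e1, e2]
    field_simp
  have hqp : q < 1 - p := by
    have : 1 < Real.exp (1 / s) := Real.one_lt_exp_iff.2 (one_div_pos.2 hs.1.1)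
    rwa [hexp, one_lt_div hq0] at this
  have hqp' : q ≤ p := by
    by_contra! h
    have hpI : p ∈ Set.Ioo (0 : ℝ) (1 / 2) := ⟨hp.1, h.trans hq1⟩
    have e1 := strictAntiOn_log_sub_ratio.antitoneOn hp₀.1 hpI hpp
    have e2 := strictMonoOn_ratio hpI ⟨hq0, hq1⟩ h
    have e3 : Real.log ((1 - p) / q) < Real.log ((1 - p) / p) := by
      refine Real.log_lt_log (div_pos (by linarith [hp.2]) hq0) ?_
      exact div_lt_div_of_pos_left (by linarith [hp.2]) hp.1 h
    rw [← hexp, Real.log_exp, ← hratio] at e3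
    have e4 := hp₀.2
    simp only at e1 e2
    linarith
  have hmgf : mgfStep p (1 / s) = p * (1 - p) / (q * (1 - q)) := by
    rw [mgfStep, hs.mul_exp_neg_inv hp, ← hq, hexp]
    have : 1 - q ≠ 0 := by linarith
    field_simp
  rw [hmgf, one_le_div (mul_pos hq0 (by linarith))]
  nlinarith [mul_nonneg (sub_nonneg.2 hqp') (sub_nonneg.2 hqp.le)]

lemma log_ratio_pos (hp : p ∈ Set.Ioo (0 : ℝ) (1 / 2)) : 0 < Real.log ((1 - p) / p) :=
  Real.log_pos ((one_lt_div hp.1).2 (by linarith [hp.2]))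

lemma mgfStep_log_ratio (hp : p ∈ Set.Ioo (0 : ℝ) (1 / 2)) :
    mgfStep p (Real.log ((1 - p) / p)) = 1 := by
  have h0 := hp.1
  have h1 : 0 < 1 - p := by linarith [hp.2]
  rw [mgfStep, Real.exp_neg, Real.exp_log (by positivity), inv_div, mul_div_cancel₀ _ h0.ne',
    mul_div_cancel₀ _ h1.ne', div_self h1.ne']

/-- The derivative of `mgfStep p`. -/
noncomputable def mgfStepDeriv (p θ : ℝ) : ℝ :=
  mgfStep p θ * (1 - (1 - p) * Real.exp (-θ) / (1 - (1 - p) * Real.exp (-θ)))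

lemma hasDerivAt_mgfStep (hp : p ∈ Set.Ioo (0 : ℝ) 1) {θ : ℝ} (hθ : 0 < θ) :
    HasDerivAt (mgfStep p) (mgfStepDeriv p θ) θ := by
  have hD : 1 - (1 - p) * Real.exp (-θ) ≠ 0 := by
    linarith [one_sub_mul_exp_neg_lt_one hp hθ]
  have h1 := (Real.hasDerivAt_exp θ).const_mul p
  have h2 := (((hasDerivAt_neg θ).exp).const_mul (1 - p)).const_sub 1
  convert! h1.div h2 hD using 1
  rw [mgfStepDeriv, mgfStep]
  field_simp

lemma continuousAt_mgfStepDeriv (hp : p ∈ Set.Ioo (0 : ℝ) 1) {θ : ℝ} (hθ : 0 < θ) :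
    ContinuousAt (mgfStepDeriv p) θ := by
  have hD : 1 - (1 - p) * Real.exp (-θ) ≠ 0 := by
    linarith [one_sub_mul_exp_neg_lt_one hp hθ]
  refine (hasDerivAt_mgfStep hp hθ).continuousAt.mul (continuousAt_const.sub
    (ContinuousAt.div ?_ ?_ hD)) <;> fun_prop

/-- Together with `IsS.cL_eq` this says that 1/s is a critical point of φ(θ)/θ. -/
lemma IsS.mgfStepDeriv_inv (hp : p ∈ Set.Ioo (0 : ℝ) 1) (hs : IsS p s) :
    mgfStepDeriv p (1 / s) = cL p s := by
  have h2 : 2 - s ≠ 0 := by linarith [hs.1.2]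
  have h3 : 1 - (1 - s) / (2 - s) = 1 / (2 - s) := by
    field_simp
    ring
  rw [mgfStepDeriv, hs.mgfStep_inv hp, hs.mul_exp_neg_inv hp, h3, cL]
  field_simp
  ring

/-- With Q = (1 - p) exp(-θ), the logarithmic derivative of φ is 1 - Q/(1 - Q), increasing in θ and
equal to s at 1/s. Below 1/s it is therefore less than s < 1/θ. -/
lemma IsS.mul_mgfStepDeriv_lt (hp : p ∈ Set.Ioo (0 : ℝ) 1) (hs : IsS p s) {θ : ℝ} (hθ : 0 < θ)
    (hθs : θ < 1 / s) : θ * mgfStepDeriv p θ < mgfStep p θ := by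
  have h1 : 0 < 1 - s := by linarith [hs.1.2]
  have h2 : 0 < 2 - s := by linarith
  have hp1 : 0 < 1 - p := by linarith [hp.2]
  set Q := (1 - p) * Real.exp (-θ) with hQ
  have hQ1 : Q < 1 := one_sub_mul_exp_neg_lt_one hp hθ
  have hQ2 : (1 - s) / (2 - s) < Q := by
    rw [← hs.mul_exp_neg_inv hp]
    exact mul_lt_mul_of_pos_left (Real.exp_lt_exp.2 (by linarith)) hp1
  have h3 : 1 - Q / (1 - Q) < s := by
    rw [sub_lt_comm, lt_div_iff₀ (by linarith)]
    rw [div_lt_iff₀ h2] at hQ2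
    nlinarith
  have h4 : θ * (1 - Q / (1 - Q)) < 1 := by
    rw [lt_div_iff₀ hs.1.1] at hθs
    nlinarith
  rw [mgfStepDeriv, ← hQ, mul_left_comm]
  exact mul_lt_of_lt_one_right (mgfStep_pos hp hθ) h4

lemma IsS.cL_pos (hp : p ∈ Set.Ioo (0 : ℝ) 1) (hs : IsS p s) : 0 < cL p s :=
  mul_pos (mul_pos (mul_pos (Real.exp_pos _) hs.1.1) (by linarith [hs.1.2])) hp.1

/-- The order of choice matters: θ just below 1/s, so that φ'(θ) still exceeds c; then c₁ < φ'(θ) <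
c₂ < φ(θ)/θ; then η small, so that difference quotients approximate φ'(θ); and α near 1 last, since
all the inequalities are strict. -/
lemma IsS.exists_tilt (hp : p ∈ Set.Ioo (0 : ℝ) 1) (hs : IsS p s) {c : ℝ} (hc : c < cL p s) :
    ∃ α ∈ Set.Ico (0 : ℝ) 1, ∃ c₁ c₂ θ η : ℝ, c < c₁ ∧ 0 ≤ c₁ ∧ 0 < η ∧ η < θ ∧
      η * c₁ + α * mgfStep p (θ - η) < α * mgfStep p θ ∧
      α * mgfStep p (θ + η) - η * c₂ < α * mgfStep p θ ∧ θ * c₂ < α * mgfStep p θ := by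
  have hs0 : 0 < 1 / s := one_div_pos.2 hs.1.1
  have hcont := continuousAt_mgfStepDeriv hp hs0
  have hmax : max c 0 < mgfStepDeriv p (1 / s) := by
    rw [hs.mgfStepDeriv_inv hp]
    exact max_lt hc (hs.cL_pos hp)
  obtain ⟨θ, ⟨hθd, hθ0⟩, hθs⟩ := ((((hcont.eventually (lt_mem_nhds hmax)).and
    (lt_mem_nhds hs0)).filter_mono nhdsWithin_le_nhds).and
    (self_mem_nhdsWithin (s := Set.Iio (1 / s)))).exists
  obtain ⟨c₁, hc₁, hc₁d⟩ := exists_between hθd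
  have hlt := hs.mul_mgfStepDeriv_lt hp hθ0 hθs
  obtain ⟨c₂, hdc₂, hc₂⟩ := exists_between ((lt_div_iff₀' hθ0).2 hlt)
  rw [lt_div_iff₀' hθ0] at hc₂
  have hder := hasDerivAt_mgfStep hp hθ0
  have hright := hder.tendsto_slope_zero_right
  have hneg : HasDerivAt (fun t => mgfStep p (θ - t)) (-mgfStepDeriv p θ) 0 :=
    HasDerivAt.comp_const_sub θ 0 (by rwa [sub_zero])
  have hleft := hneg.tendsto_slope_zero_right
  obtain ⟨η, ⟨⟨hr, hl⟩, hηθ⟩, hη⟩ := ((((hright.eventually (gt_mem_nhds hdc₂)).and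
    (hleft.eventually (gt_mem_nhds (neg_lt_neg hc₁d)))).and
    (nhdsWithin_le_nhds (gt_mem_nhds hθ0))).and (self_mem_nhdsWithin (s := Set.Ioi 0))).exists
  simp only [smul_eq_mul, zero_add, sub_zero] at hr hl
  have hη0 : 0 < η := hη
  rw [inv_mul_lt_iff₀ hη0] at hr hl
  have hcα : ∀ A B : ℝ, ContinuousAt (fun α : ℝ => α * A + B) 1 := fun A B => by fun_prop
  have e1 : ∀ᶠ α : ℝ in 𝓝 1, η * c₁ < α * (mgfStep p θ - mgfStep p (θ - η)) + 0 :=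
    (hcα _ _).eventually (lt_mem_nhds (by linarith))
  have e2 : ∀ᶠ α : ℝ in 𝓝 1, α * (mgfStep p (θ + η) - mgfStep p θ) + 0 < η * c₂ :=
    (hcα _ _).eventually (gt_mem_nhds (by linarith))
  have e3 : ∀ᶠ α : ℝ in 𝓝 1, θ * c₂ < α * mgfStep p θ + 0 :=
    (hcα _ _).eventually (lt_mem_nhds (by linarith))
  obtain ⟨α, ⟨⟨⟨a1, a2⟩, a3⟩, a4⟩, a5⟩ := (((((e1.and e2).and e3).and
    (lt_mem_nhds (zero_lt_one' ℝ))).filter_mono nhdsWithin_le_nhds).and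
    (self_mem_nhdsWithin (s := Set.Iio (1 : ℝ)))).exists
  exact ⟨α, ⟨a4.le, a5⟩, c₁, c₂, θ, η, (le_max_left _ _).trans_lt hc₁,
    ((le_max_right _ _).trans_lt hc₁).le, hη0, hηθ, by linarith, by linarith, by linarith⟩

end constants

/-! ### The two tails for the tree, and the theorem -/

theorem tendsto_height_lt {p s : ℝ} (hp : p ∈ Set.Ioo (0 : ℝ) 1) (hs : IsS p s) {c : ℝ}
    (hc : c < cL p s) :
    Tendsto (fun m : ℕ => ((surferTree ⟨p, Set.Ioo_subset_Icc_self hp⟩ m).map height).toMeasure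
      {h : ℕ | (h : ℝ) < c * Real.log ((m + 1 : ℕ) : ℝ)}) atTop (𝓝 0) := by
  obtain ⟨α, hα, c₁, c₂, θ, η, h1, h2, h3, h4, h5, h6, h7⟩ := hs.exists_tilt hp hc
  simp only [map_height_surferTree]
  exact tendsto_lowerTail hp hα h1 h2 h3 h4 h5 h6 h7

theorem tendsto_lt_height {p s p₀ : ℝ} (hp : p ∈ Set.Ioo (0 : ℝ) 1) (hs : IsS p s)
    (hp₀ : IsP0 p₀) {c : ℝ} (hc : cU p₀ p s < c) :
    Tendsto (fun m : ℕ => ((surferTree ⟨p, Set.Ioo_subset_Icc_self hp⟩ m).map height).toMeasure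
      {h : ℕ | c * Real.log ((m + 1 : ℕ) : ℝ) < (h : ℝ)}) atTop (𝓝 0) := by
  simp only [map_height_surferTree]
  rw [cU] at hc
  split_ifs at hc with hpp
  · rw [hs.cL_eq hp] at hc
    exact tendsto_upperTail hp (one_div_pos.2 hs.1.1) (hs.one_le_mgfStep_inv hp hp₀ hpp) hc
  · have hpI : p ∈ Set.Ioo (0 : ℝ) (1 / 2) := ⟨hp.1, (not_le.1 hpp).trans hp₀.1.2⟩
    have h1 := mgfStep_log_ratio hpI
    refine tendsto_upperTail hp (log_ratio_pos hpI) h1.ge ?_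
    rwa [h1, one_div]

end RandomSurfer
theorem theorem2 :
    -- `s(p)` and `p₀` are well defined, and `p₀ ≈ 0.206`
    (∀ p ∈ Set.Ioo (0 : ℝ) 1, ∃! s, RandomSurfer.IsS p s) ∧
    (∃! p₀, RandomSurfer.IsP0 p₀) ∧
    (∀ p₀, RandomSurfer.IsP0 p₀ → |p₀ - 0.206| < 0.0005) ∧
    -- the bounds for the height of the random-surfer tree on `m + 1` vertices
    ∀ (p : ℝ) (hp : p ∈ Set.Ioo (0 : ℝ) 1) (s p₀ : ℝ),
      RandomSurfer.IsS p s → RandomSurfer.IsP0 p₀ → ∀ ε : ℝ, 0 < ε →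
        Tendsto
          (fun m : ℕ =>
            ((RandomSurfer.surferTree ⟨p, Set.Ioo_subset_Icc_self hp⟩ m).map
              RandomSurfer.height).toMeasure
              {h : ℕ |
                (RandomSurfer.cL p s - ε) * Real.log ((m + 1 : ℕ) : ℝ) ≤ (h : ℝ) ∧
                (h : ℝ) ≤ (RandomSurfer.cU p₀ p s + ε) * Real.log ((m + 1 : ℕ) : ℝ)})
          atTop (𝓝 1) := by
  refine ⟨fun p hp => RandomSurfer.existsUnique_isS hp, RandomSurfer.existsUnique_isP0,
    fun p₀ h => h.abs_sub_lt, fun p hp s p₀ hs hp₀ ε hε => ?_⟩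
  have hlow := RandomSurfer.tendsto_height_lt hp hs (sub_lt_self _ hε)
  have hupp := RandomSurfer.tendsto_lt_height hp hs hp₀ (lt_add_of_pos_right _ hε)
  have hsum := hlow.add hupp
  rw [add_zero] at hsum
  have hlim := ENNReal.Tendsto.sub (tendsto_const_nhds (x := (1 : ENNReal))) hsum
    (Or.inl ENNReal.one_ne_top)
  rw [tsub_zero] at hlim
  refine tendsto_of_tendsto_of_tendsto_of_le_of_le hlim tendsto_const_nhds (fun m => ?_)
    fun m => prob_le_one
  rw [tsub_le_iff_right]
  set μ := ((RandomSurfer.surferTree ⟨p, Set.Ioo_subset_Icc_self hp⟩ m).map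
    RandomSurfer.height).toMeasure
  rw [← measure_univ (μ := μ)]
  refine (measure_mono fun h _ => ?_).trans ((measure_union_le _ _).trans
    (add_le_add le_rfl (measure_union_le _ _)))
  simp only [Set.mem_union, Set.mem_ofPred_eq]
  by_cases h1 : (RandomSurfer.cL p s - ε) * Real.log ((m + 1 : ℕ) : ℝ) ≤ (h : ℝ)
  · by_cases h2 : (h : ℝ) ≤ (RandomSurfer.cU p₀ p s + ε) * Real.log ((m + 1 : ℕ) : ℝ)
    · exact Or.inl ⟨h1, h2⟩
    · exact Or.inr (Or.inr (not_le.1 h2))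
  · exact Or.inr (Or.inl (not_le.1 h1))
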